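/- There are absolute constants $K, C > 0$ such that the following holds for all integers $d \ge 1$ and $n \ge K d^{4/3}$. Let $U = (u_1, \ldots, u_n)$ be a random frame, where $u_1, \ldots, u_n$ are independent random vectors, each uniformly distributed on the sphere of radius $\sqrt{d/n}$ centred at the origin of $\mathbb{R}^d$ (so $\|u_i\|_2^2 = d/n$). Then, with probability at least $0.99$, the following holds for every real $\varepsilon$: if $$(1-\varepsilon) I_d \preceq \sum_{i=1}^n u_i u_i^* \preceq (1+\varepsilon) I_d,$$ then there is a frame $V = (v_1, \ldots, v_n)$ of vectors in $\mathbb{R}^d$ with $$\sum_{i=1}^n v_i v_i^* = I_d, \qquad \|v_i\|_2^2 = \frac{d}{n} \ \text{ for } 1 \le i \le n, \qquad \text{and} \qquad \sum_{i=1}^n \|u_i - v_i\|_2^2 \le C\, d\, \varepsilon^2.$$ -/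

import Mathlib

open MeasureTheory ProbabilityTheory

noncomputable section

/-- The uniform probability measure on the sphere of radius `r` centred at the origin of `ℝ^d`,
as a measure on `ℝ^d`: the surface measure of the unit sphere, normalized to total mass one, is
pushed forward along `x ↦ r x`. It is meant for `1 ≤ d` and `0 ≤ r`. -/
def uniformSphere (d : ℕ) (r : ℝ) : Measure (EuclideanSpace ℝ (Fin d)) :=
  Measure.map
    (fun x : Metric.sphere (0 : EuclideanSpace ℝ (Fin d)) 1 => r • (x : EuclideanSpace ℝ (Fin d)))
    (((volume : Measure (EuclideanSpace ℝ (Fin d))).toSphere Set.univ)⁻¹ •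
      (volume : Measure (EuclideanSpace ℝ (Fin d))).toSphere)

/-- The frame operator `∑ i, u_i u_i^*` of `U = (u_1, …, u_n)`, a `d × d` matrix. -/
def frameOperator {d n : ℕ} (U : Fin n → EuclideanSpace ℝ (Fin d)) :
    Matrix (Fin d) (Fin d) ℝ :=
  ∑ i, Matrix.vecMulVec (U i).ofLp (U i).ofLp

/-- `(1 - ε) I_d ≼ ∑ i, u_i u_i^* ≼ (1 + ε) I_d` in the Loewner order. -/
def IsNearlyParseval {d n : ℕ} (ε : ℝ) (U : Fin n → EuclideanSpace ℝ (Fin d)) : Prop :=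
  (frameOperator U - (1 - ε) • (1 : Matrix (Fin d) (Fin d) ℝ)).PosSemidef ∧
    ((1 + ε) • (1 : Matrix (Fin d) (Fin d) ℝ) - frameOperator U).PosSemidef

/-- A doubly balanced frame of size `d`: it is Parseval and all its vectors have squared
Euclidean norm `d / n`. -/
def IsDoublyBalanced {d n : ℕ} (V : Fin n → EuclideanSpace ℝ (Fin d)) : Prop :=
  frameOperator V = 1 ∧ ∀ i, ‖V i‖ ^ 2 = (d : ℝ) / n

/-- The squared distance `∑ i, ‖u_i - v_i‖²` between two frames. -/
def frameDist {d n : ℕ} (U V : Fin n → EuclideanSpace ℝ (Fin d)) : ℝ :=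
  ∑ i, ‖U i - V i‖ ^ 2

end

/-! ### Weighted frame operators and the Frobenius norm. -/

section FrameOperators

open Module
open scoped RealInnerProductSpace

variable {E : Type*} [NormedAddCommGroup E] [InnerProductSpace ℝ E]
variable {ι κ : Type*} [Fintype ι] [Fintype κ]

/-! Rescale to unit vectors `x i`, put `w = d / n`, let `S` be the weighted frame operator and `D =
S - 1` its error. The balanced frame is the limit of an alternating scaling: replace `x i` by `z i =
S^{-1/2} x i`, which is Parseval, then normalize to `y i = z i / ‖z i‖`.

Contraction (`exists_scaling_step`). Let `D` now be the error of `y`. Unit norms make `D` traceless,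
so `‖D‖_F² = w ∑ ⟪y i, D (y i)⟫`, while the Parseval property of `z` gives `0 = tr D = w ∑ ‖z i‖² ⟪y
i, D (y i)⟫`. Subtracting, `‖D‖_F² = w ∑ ⟪y i, D (y i)⟫ (1 - ‖z i‖²)`. By Cauchy–Schwarz the error
contracts by a fixed factor as soon as `w ∑ ⟪y i, X (y i)⟫²` is at most a suitable constant below
one times `‖X‖_F²` for all traceless symmetric `X`; this is `QuadBound`.

Persistence (`exists_scaling_sequence`). `QuadBound` survives while every vector stays within `1 /
100` of its start. If the initial error has operator norm at most `e`, one step moves a vector by a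
multiple of the minimum of `e` and the current Frobenius error, itself at most `(9/10)^k √d e`.
Interpolating between the two bounds the total motion by a multiple of `e d^{1/6}`. The squared
distance to the limit is then at most a constant times the initial squared Frobenius error, hence of
order `d ε²`.

Randomness (`exists_good_event`). A Chernoff bound over a net gives `e` of order `√(d/n)`, so `e
d^{1/6}` is small exactly when `n` is a large multiple of `d^{4/3}`. For `QuadBound`, the traceless
parts of `x xᵀ` have covariance of operator norm at most `2 / (d (d + 2))`; the deviation of their
empirical second moment matrix is controlled by the expected trace of its fourth power. After
scaling, that expectation is at most `16 (d/n)² + 48 (d^{4/3}/n)³`, and the exponent `4/3` appears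
again. The event does not involve `ε`, which enters only through the initial Frobenius error. -/

/-- The weighted frame operator `v ↦ w ∑ i, ⟪x i, v⟫ x i`. -/
noncomputable def frameMap (w : ℝ) (x : κ → E) : E →ₗ[ℝ] E where
  toFun v := w • ∑ i, ⟪x i, v⟫ • x i
  map_add' u v := by
    simp only [inner_add_right, add_smul, Finset.sum_add_distrib, smul_add]
  map_smul' c v := by
    simp only [inner_smul_right, mul_smul, ← Finset.smul_sum, RingHom.id_apply]
    rw [smul_comm]

/-- The squared Frobenius norm of `X`, computed in the orthonormal basis `b`. -/
noncomputable def frobSq (b : OrthonormalBasis ι ℝ E) (X : E →ₗ[ℝ] E) : ℝ := ∑ j, ‖X (b j)‖ ^ 2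

/-- The frame operator of `x`, weighted by `w`, lies between `1 - e` and `1 + e`. -/
def NearParseval (w e : ℝ) (x : κ → E) : Prop :=
  ∀ v, (1 - e) * ‖v‖ ^ 2 ≤ w * ∑ i, ⟪x i, v⟫ ^ 2 ∧ w * ∑ i, ⟪x i, v⟫ ^ 2 ≤ (1 + e) * ‖v‖ ^ 2

theorem frameMap_apply (w : ℝ) (x : κ → E) (v : E) :
    frameMap w x v = w • ∑ i, ⟪x i, v⟫ • x i := rfl

theorem inner_frameMap (w : ℝ) (x : κ → E) (u v : E) :
    ⟪u, frameMap w x v⟫ = w * ∑ i, ⟪x i, u⟫ * ⟪x i, v⟫ := by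
  simp only [frameMap_apply, inner_smul_right, inner_sum]
  congr 1
  refine Finset.sum_congr rfl fun i _ => ?_
  rw [real_inner_comm u (x i), mul_comm]

theorem inner_frameMap_self (w : ℝ) (x : κ → E) (v : E) :
    ⟪v, frameMap w x v⟫ = w * ∑ i, ⟪x i, v⟫ ^ 2 := by
  simp only [inner_frameMap, sq]

theorem frameMap_isSymmetric (w : ℝ) (x : κ → E) : (frameMap w x).IsSymmetric := by
  intro u v
  rw [real_inner_comm, inner_frameMap, inner_frameMap]
  simp only [mul_comm]

theorem frobSq_nonneg (b : OrthonormalBasis ι ℝ E) (X : E →ₗ[ℝ] E) : 0 ≤ frobSq b X :=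
  Finset.sum_nonneg fun _ _ => sq_nonneg _

theorem sum_inner_sq_eq (b : OrthonormalBasis ι ℝ E) (v : E) : ∑ a, ⟪b a, v⟫ ^ 2 = ‖v‖ ^ 2 := by
  have := b.sum_sq_norm_inner_right v
  simpa [Real.norm_eq_abs, sq_abs] using this

theorem norm_apply_sq_le (b : OrthonormalBasis ι ℝ E) {X : E →ₗ[ℝ] E} (hX : X.IsSymmetric)
    (v : E) : ‖X v‖ ^ 2 ≤ frobSq b X * ‖v‖ ^ 2 := by
  rw [← sum_inner_sq_eq b, frobSq, Finset.sum_mul]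
  refine Finset.sum_le_sum fun a _ => ?_
  rw [← hX, ← mul_pow]
  exact sq_le_sq' (by have := abs_real_inner_le_norm (X (b a)) v; rw [abs_le] at this; linarith)
    (real_inner_le_norm _ _)

theorem sum_norm_apply_sq (b : OrthonormalBasis ι ℝ E) (w : ℝ) (x : κ → E) {X : E →ₗ[ℝ] E}
    (hX : X.IsSymmetric) :
    w * ∑ i, ‖X (x i)‖ ^ 2 = ∑ a, w * ∑ i, ⟪x i, X (b a)⟫ ^ 2 := by
  rw [← Finset.mul_sum, Finset.sum_comm]
  congr 1
  refine Finset.sum_congr rfl fun i _ => ?_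
  rw [← sum_inner_sq_eq b]
  refine Finset.sum_congr rfl fun a _ => ?_
  rw [← hX, real_inner_comm]

/-- The left side is `tr (X S X)`, with `S` the frame operator, and `S ≤ 1 + e`. -/
theorem sum_norm_apply_sq_le (b : OrthonormalBasis ι ℝ E) {w e : ℝ} {x : κ → E}
    (hx : NearParseval w e x) {X : E →ₗ[ℝ] E} (hX : X.IsSymmetric) :
    w * ∑ i, ‖X (x i)‖ ^ 2 ≤ (1 + e) * frobSq b X := by
  rw [sum_norm_apply_sq b w x hX, frobSq, Finset.mul_sum]
  exact Finset.sum_le_sum fun a _ => (hx _).2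

/-- Both sides are the Frobenius inner product of `X` with the frame operator. -/
theorem sum_inner_frameMap (b : OrthonormalBasis ι ℝ E) (w : ℝ) (x : κ → E) (X : E →ₗ[ℝ] E) :
    ∑ a, ⟪X (b a), frameMap w x (b a)⟫ = w * ∑ i, ⟪x i, X (x i)⟫ := by
  simp only [inner_frameMap]
  rw [← Finset.mul_sum, Finset.sum_comm]
  congr 1
  refine Finset.sum_congr rfl fun i _ => ?_
  conv_rhs => rw [← b.sum_repr' (x i)]
  simp only [map_sum, map_smul, inner_sum, inner_smul_right]
  refine Finset.sum_congr rfl fun a _ => ?_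
  rw [b.sum_repr', mul_comm, real_inner_comm (b a)]

theorem sum_inner_frameMap_self (b : OrthonormalBasis ι ℝ E) (w : ℝ) (x : κ → E) :
    ∑ a, ⟪b a, frameMap w x (b a)⟫ = w * ∑ i, ‖x i‖ ^ 2 := by
  simpa using sum_inner_frameMap b w x LinearMap.id

/-- The frame operator minus the identity. -/
noncomputable def frameError (w : ℝ) (x : κ → E) : E →ₗ[ℝ] E := frameMap w x - LinearMap.id

theorem frameError_isSymmetric (w : ℝ) (x : κ → E) : (frameError w x).IsSymmetric :=
  (frameMap_isSymmetric w x).sub LinearMap.IsSymmetric.id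

theorem inner_frameError_self (w : ℝ) (x : κ → E) (v : E) :
    ⟪v, frameError w x v⟫ = w * ∑ i, ⟪x i, v⟫ ^ 2 - ‖v‖ ^ 2 := by
  simp [frameError, inner_sub_right, inner_frameMap_self]

/-- Unit vectors give the frame operator trace `w * card κ`, the dimension. This puts the error
among the traceless operators to which `QuadBound` applies. -/
theorem trace_frameError (b : OrthonormalBasis ι ℝ E) {w : ℝ} {x : κ → E}
    (hx : ∀ i, ‖x i‖ = 1) (hw : w * Fintype.card κ = Fintype.card ι) :
    ∑ a, ⟪b a, frameError w x (b a)⟫ = 0 := by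
  simp only [frameError, LinearMap.sub_apply, inner_sub_right, Finset.sum_sub_distrib,
    sum_inner_frameMap_self, hx]
  simp [hw]

/-- The operator with eigenvalues `f k` at the vectors of the orthonormal basis `b`. -/
noncomputable def diagMap (b : OrthonormalBasis ι ℝ E) (f : ι → ℝ) : E →ₗ[ℝ] E where
  toFun v := ∑ k, (f k * ⟪b k, v⟫) • b k
  map_add' u v := by simp only [inner_add_right, mul_add, add_smul, Finset.sum_add_distrib]
  map_smul' c v := by
    simp only [inner_smul_right, Finset.smul_sum, smul_smul, RingHom.id_apply]
    exact Finset.sum_congr rfl fun k _ => by congr 1; ring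

theorem diagMap_basis (b : OrthonormalBasis ι ℝ E) (f : ι → ℝ) (k : ι) :
    diagMap b f (b k) = f k • b k := by
  classical
  change ∑ j, (f j * ⟪b j, b k⟫) • b j = _
  simp [b.inner_eq_ite]

theorem diagMap_isSymmetric (b : OrthonormalBasis ι ℝ E) (f : ι → ℝ) :
    (diagMap b f).IsSymmetric := by
  intro u v
  change ⟪∑ k, (f k * ⟪b k, u⟫) • b k, v⟫ = ⟪u, ∑ k, (f k * ⟪b k, v⟫) • b k⟫
  simp only [sum_inner, inner_sum, inner_smul_left, inner_smul_right, conj_trivial]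
  refine Finset.sum_congr rfl fun k _ => ?_
  rw [real_inner_comm u (b k)]
  ring

/-- A symmetric operator `S ≥ 1 - e` has a symmetric inverse square root, whose distance to the
identity is controlled pointwise by that of `S`. -/
theorem exists_inverse_sqrt [FiniteDimensional ℝ E] {S : E →ₗ[ℝ] E} (hS : S.IsSymmetric) {e : ℝ}
    (he : e ≤ 1 / 100) (hl : ∀ v, (1 - e) * ‖v‖ ^ 2 ≤ ⟪v, S v⟫) :
    ∃ R : E →ₗ[ℝ] E, R.IsSymmetric ∧ (∀ v, R (S (R v)) = v) ∧
      ∀ v, ‖R v - v‖ ≤ 11 / 20 * ‖S v - v‖ := by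
  set b := hS.eigenvectorBasis rfl with hb
  set l := hS.eigenvalues rfl with hl'
  have hSb : ∀ k, S (b k) = l k • b k := fun k => hS.apply_eigenvectorBasis rfl k
  have hl1 : ∀ k, 99 / 100 ≤ l k := by
    intro k
    have := hl (b k)
    rw [hSb, inner_smul_right, real_inner_self_eq_norm_sq, b.norm_eq_one] at this
    linarith
  set f : Fin (finrank ℝ E) → ℝ := fun k => (Real.sqrt (l k))⁻¹ with hf
  set R : E →ₗ[ℝ] E := diagMap b f
  have hRb : ∀ k, R (b k) = f k • b k := diagMap_basis b f
  have hRs : R.IsSymmetric := diagMap_isSymmetric b f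
  refine ⟨R, hRs, ?_, ?_⟩
  · have : R ∘ₗ S ∘ₗ R = LinearMap.id := by
      refine b.toBasis.ext fun k => ?_
      have h0 : 0 < l k := by linarith [hl1 k]
      simp only [OrthonormalBasis.coe_toBasis, LinearMap.comp_apply, hRb, map_smul, hSb, smul_smul,
        LinearMap.id_apply]
      have : f k * l k * f k = 1 := by
        have h1 := Real.sq_sqrt h0.le
        have h2 : Real.sqrt (l k) ≠ 0 := (Real.sqrt_pos.2 h0).ne'
        simp only [hf]
        field_simp
        nlinarith
      rw [this, one_smul]
    intro v
    simpa using LinearMap.congr_fun this v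
  · intro v
    refine le_of_sq_le_sq ?_ (by positivity)
    rw [mul_pow, ← sum_inner_sq_eq b, ← sum_inner_sq_eq b (S v - v), Finset.mul_sum]
    refine Finset.sum_le_sum fun k _ => ?_
    rw [inner_sub_right, inner_sub_right, ← hRs, ← hS, hRb, hSb, inner_smul_left, inner_smul_left]
    simp only [conj_trivial]
    have h0 : 0 < l k := by linarith [hl1 k]
    have h1 := Real.sq_sqrt h0.le
    set s := Real.sqrt (l k) with hs
    have hs9 : (99 / 100 : ℝ) ≤ s := by
      rw [hs]
      refine Real.le_sqrt_of_sq_le ?_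
      linarith [hl1 k]
    have hs0 : 0 < s := by linarith
    have hfk : f k * s = 1 := by simp only [hf]; exact inv_mul_cancel₀ hs0.ne'
    rw [← h1]
    -- With `s² = λ` an eigenvalue, `1/s - 1 = -(s² - 1) / (s (s + 1))`; for `s ≥ 99/100` the factor
    -- is just above one half, below `11/20`.
    have key : f k - 1 = - (f k / (s + 1)) * (s ^ 2 - 1) := by
      field_simp
      nlinarith
    have : f k * ⟪b k, v⟫ - ⟪b k, v⟫ = (- (f k / (s + 1))) * (s ^ 2 * ⟪b k, v⟫ - ⟪b k, v⟫) := by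
      linear_combination ⟪b k, v⟫ * key
    rw [this, mul_pow]
    refine mul_le_mul_of_nonneg_right ?_ (sq_nonneg _)
    rw [neg_sq]
    have hfpos : 0 ≤ f k := by simp only [hf]; positivity
    refine pow_le_pow_left₀ (by positivity) ?_ 2
    rw [div_le_iff₀ (by positivity)]
    have : f k ≤ 100 / 99 := by nlinarith
    nlinarith

theorem NearParseval.norm_frameError_le [FiniteDimensional ℝ E] {w e : ℝ} {x : κ → E}
    (hx : NearParseval w e x) (he : 0 ≤ e) (v : E) : ‖frameError w x v‖ ≤ e * ‖v‖ := by
  have hD := frameError_isSymmetric w x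
  set b := hD.eigenvectorBasis rfl
  set l := hD.eigenvalues rfl
  have hDb : ∀ k, frameError w x (b k) = l k • b k := fun k => hD.apply_eigenvectorBasis rfl k
  have hl1 : ∀ k, l k ^ 2 ≤ e ^ 2 := by
    intro k
    have h1 := inner_frameError_self w x (b k)
    have h2 := hx (b k)
    rw [hDb, inner_smul_right, real_inner_self_eq_norm_sq, b.norm_eq_one] at h1
    rw [b.norm_eq_one] at h2
    exact sq_le_sq' (by linarith) (by linarith)
  refine le_of_sq_le_sq ?_ (by positivity)
  rw [mul_pow, ← sum_inner_sq_eq b, ← sum_inner_sq_eq b v, Finset.mul_sum]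
  refine Finset.sum_le_sum fun k _ => ?_
  rw [← hD, hDb, inner_smul_left, mul_pow]
  exact mul_le_mul_of_nonneg_right (by simpa using hl1 k) (sq_nonneg _)

end FrameOperators

/-! ### One step of the scaling iteration. -/

section SinkhornStep

open Module
open scoped RealInnerProductSpace

variable {E : Type*} [NormedAddCommGroup E] [InnerProductSpace ℝ E]
variable {ι κ : Type*} [Fintype ι] [Fintype κ]

/-- The quadratic forms `X ↦ ⟪x i, X (x i)⟫` are jointly bounded by `g` on traceless symmetric
operators. -/
def QuadBound (b : OrthonormalBasis ι ℝ E) (w g : ℝ) (x : κ → E) : Prop :=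
  ∀ X : E →ₗ[ℝ] E, X.IsSymmetric → ∑ a, ⟪b a, X (b a)⟫ = 0 →
    w * ∑ i, ⟪x i, X (x i)⟫ ^ 2 ≤ g ^ 2 * frobSq b X

/-- Polarization writes the change of the quadratic form as `⟪y - x, X (y + x)⟫`, which is at most
`1/100` times norms of `X x` and `X y`; those are square-summable by the frame bounds. The slack
between `(3/4)²` and `(39/50)²` absorbs it. -/
theorem QuadBound.of_close {b : OrthonormalBasis ι ℝ E} {w e : ℝ} {x y : κ → E}
    (hw : 0 ≤ w) (he : e ≤ 1 / 100) (hx : NearParseval w e x) (hy : NearParseval w e y)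
    (hxy : ∀ i, ‖y i - x i‖ ≤ 1 / 100) (hg : QuadBound b w (3 / 4) x) :
    QuadBound b w (39 / 50) y := by
  intro X hX hX0
  have h1 := hg X hX hX0
  have h2 := sum_norm_apply_sq_le b hx hX
  have h3 := sum_norm_apply_sq_le b hy hX
  have hF := frobSq_nonneg b X
  have key : ∀ i, ⟪y i, X (y i)⟫ ^ 2 ≤ 21 / 20 * ⟪x i, X (x i)⟫ ^ 2 +
      42 / 10000 * (‖X (x i)‖ ^ 2 + ‖X (y i)‖ ^ 2) := by
    intro i
    have e1 : ⟪y i, X (y i)⟫ = ⟪x i, X (x i)⟫ + ⟪y i - x i, X (y i) + X (x i)⟫ := by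
      have : ⟪y i, X (x i)⟫ = ⟪x i, X (y i)⟫ := by rw [← hX, real_inner_comm]
      simp only [inner_sub_left, inner_add_right]
      linarith
    set p := ⟪x i, X (x i)⟫
    set q := ⟪y i - x i, X (y i) + X (x i)⟫
    have hq : |q| ≤ 1 / 100 * (‖X (x i)‖ + ‖X (y i)‖) := by
      refine (abs_real_inner_le_norm _ _).trans ?_
      refine mul_le_mul (hxy i) ?_ (norm_nonneg _) (by norm_num)
      rw [add_comm]
      exact norm_add_le _ _
    have hq2 : q ^ 2 ≤ 1 / 10000 * (2 * (‖X (x i)‖ ^ 2 + ‖X (y i)‖ ^ 2)) := by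
      have := sq_le_sq' (by linarith [neg_abs_le q, abs_nonneg q]) ((le_abs_self q).trans hq)
      nlinarith [sq_nonneg (‖X (x i)‖ - ‖X (y i)‖)]
    rw [e1]
    nlinarith [sq_nonneg (p - 20 * q)]
  have h4 : w * ∑ i, ⟪y i, X (y i)⟫ ^ 2 ≤ 21 / 20 * (w * ∑ i, ⟪x i, X (x i)⟫ ^ 2) +
      42 / 10000 * (w * ∑ i, ‖X (x i)‖ ^ 2 + w * ∑ i, ‖X (y i)‖ ^ 2) := by
    have := mul_le_mul_of_nonneg_left (Finset.sum_le_sum fun i (_ : i ∈ Finset.univ) => key i) hw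
    refine this.trans (le_of_eq ?_)
    simp only [Finset.sum_add_distrib, ← Finset.mul_sum]
    ring
  have h5 : e * frobSq b X ≤ 1 / 100 * frobSq b X := mul_le_mul_of_nonneg_right he hF
  nlinarith

/-- One step of the scaling iteration: apply the inverse square root of the frame operator, then
normalize. -/
theorem exists_scaling_step [FiniteDimensional ℝ E] (b : OrthonormalBasis ι ℝ E) {w e : ℝ}
    {x : κ → E} (hw : 0 ≤ w) (he : e ≤ 1 / 100) (hn : ∀ i, ‖x i‖ = 1)
    (hc : w * Fintype.card κ = Fintype.card ι) (hx : NearParseval w e x) :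
    ∃ y : κ → E, (∀ i, ‖y i‖ = 1) ∧ NearParseval w e y ∧
      (∀ i, ‖y i - x i‖ ≤ 11 / 10 * ‖frameError w x (x i)‖) ∧
      (QuadBound b w (39 / 50) y →
        frobSq b (frameError w y) ≤ (9 / 10) ^ 2 * frobSq b (frameError w x)) := by
  obtain ⟨R, hRs, hRSR, hR1⟩ := exists_inverse_sqrt (frameMap_isSymmetric w x) he
    (fun v => by rw [inner_frameMap_self]; exact (hx v).1)
  set z : κ → E := fun i => R (x i) with hz
  -- `⟪z, S z⟫ = ‖x‖² = 1` because `R S R = 1`. Hence `‖z i‖⁻²` lies in `[1 - e, 1 + e]`, and as `z`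
  -- is Parseval the normalized vectors keep the same operator bound `e`.
  have hzS : ∀ i, w * ∑ j, ⟪x j, z i⟫ ^ 2 = 1 := by
    intro i
    rw [← inner_frameMap_self, hz]
    simp only
    rw [hRs, hRSR, real_inner_self_eq_norm_sq, hn, one_pow]
  have hz1 : ∀ i, (1 - e) * ‖z i‖ ^ 2 ≤ 1 := fun i => (hzS i) ▸ (hx (z i)).1
  have hz2 : ∀ i, 1 ≤ (1 + e) * ‖z i‖ ^ 2 := fun i => (hzS i) ▸ (hx (z i)).2
  have hzpos : ∀ i, 0 < ‖z i‖ := by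
    intro i
    rcases (norm_nonneg (z i)).eq_or_lt with h | h
    · have := hz2 i
      rw [← h] at this
      norm_num at this
    · exact h
  have hzle : ∀ i, ‖z i‖ ≤ 101 / 100 := by
    intro i
    have := hz1 i
    by_contra! h
    nlinarith [sq_nonneg (‖z i‖)]
  have hSz : ∀ u v, w * ∑ i, ⟪z i, u⟫ * ⟪z i, v⟫ = ⟪u, v⟫ := by
    intro u v
    have : ∀ i, ⟪z i, u⟫ * ⟪z i, v⟫ = ⟪x i, R u⟫ * ⟪x i, R v⟫ := fun i => by
      simp only [hz, hRs (x i)]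
    simp only [this]
    rw [← inner_frameMap, hRs, hRSR]
  have hSz' : frameMap w z = LinearMap.id := by
    refine LinearMap.ext fun v => ext_inner_left ℝ fun u => ?_
    rw [inner_frameMap, hSz, LinearMap.id_apply]
  have hdiff : ∀ i, ‖z i - x i‖ ≤ 11 / 20 * ‖frameError w x (x i)‖ := fun i => by
    simpa [frameError] using hR1 (x i)
  refine ⟨fun i => ‖z i‖⁻¹ • z i, ?_, ?_, ?_, ?_⟩
  · intro i
    rw [norm_smul, norm_inv, norm_norm, inv_mul_cancel₀ (hzpos i).ne']
  · intro v
    have hv : w * ∑ i, ⟪z i, v⟫ ^ 2 = ‖v‖ ^ 2 := by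
      simpa only [sq, real_inner_self_eq_norm_mul_norm] using hSz v v
    have ht : ∀ i, ⟪‖z i‖⁻¹ • z i, v⟫ ^ 2 = (‖z i‖ ^ 2)⁻¹ * ⟪z i, v⟫ ^ 2 := fun i => by
      rw [inner_smul_left, mul_pow, conj_trivial, inv_pow]
    simp only [ht]
    rw [← hv, mul_left_comm, mul_left_comm (1 + e)]
    constructor
    · refine mul_le_mul_of_nonneg_left ?_ hw
      rw [Finset.mul_sum]
      refine Finset.sum_le_sum fun i _ => mul_le_mul_of_nonneg_right ?_ (sq_nonneg _)
      rw [← one_div, le_div_iff₀ (pow_pos (hzpos i) 2)]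
      exact hz1 i
    · refine mul_le_mul_of_nonneg_left ?_ hw
      rw [Finset.mul_sum]
      refine Finset.sum_le_sum fun i _ => mul_le_mul_of_nonneg_right ?_ (sq_nonneg _)
      rw [← one_div, div_le_iff₀ (pow_pos (hzpos i) 2)]
      exact hz2 i
  · intro i
    -- Normalizing moves `z i` by `|1 - ‖z i‖| = |‖x i‖ - ‖z i‖|`, so the total motion is at most
    -- twice `‖z i - x i‖`; hence `11/10 = 2 * 11/20`.
    have h1 : ‖‖z i‖⁻¹ • z i - z i‖ ≤ ‖z i - x i‖ := by
      have : ‖z i‖⁻¹ • z i - z i = (‖z i‖⁻¹ - 1) • z i := by rw [sub_smul, one_smul]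
      rw [this, norm_smul, Real.norm_eq_abs, ← abs_of_pos (hzpos i), ← abs_mul,
        abs_of_pos (hzpos i), sub_mul, inv_mul_cancel₀ (hzpos i).ne', one_mul, ← hn i, abs_sub_comm]
      exact abs_norm_sub_norm_le _ _
    have h2 := norm_add_le (‖z i‖⁻¹ • z i - z i) (z i - x i)
    rw [sub_add_sub_cancel] at h2
    linarith [hdiff i]
  · set y : κ → E := fun i => ‖z i‖⁻¹ • z i with hy
    intro hQ
    have hyn : ∀ i, ‖y i‖ = 1 := fun i => by
      rw [hy, norm_smul, norm_inv, norm_norm, inv_mul_cancel₀ (hzpos i).ne']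
    set D := frameError w y with hD
    have hDs : D.IsSymmetric := frameError_isSymmetric w y
    have htr : ∑ a, ⟪b a, D (b a)⟫ = 0 := trace_frameError b hyn hc
    have hF' : frobSq b D = w * ∑ i, ⟪y i, D (y i)⟫ := by
      rw [← sum_inner_frameMap b, frobSq]
      have : ∀ a, ‖D (b a)‖ ^ 2 = ⟪D (b a), frameMap w y (b a)⟫ - ⟪b a, D (b a)⟫ := fun a => by
        rw [← real_inner_self_eq_norm_sq, real_inner_comm (D (b a)) (b a), ← inner_sub_right]
        rfl
      simp only [this, Finset.sum_sub_distrib, htr, sub_zero]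
    -- The frame operator of `z` is the identity, so its pairing with `D` is `tr D = 0`. Subtracting
    -- this from `hF'` produces the small factor `1 - ‖z i‖²`.
    have hz0 : w * ∑ i, ‖z i‖ ^ 2 * ⟪y i, D (y i)⟫ = 0 := by
      have h1 := sum_inner_frameMap b w z D
      rw [hSz'] at h1
      have h2 : ∀ i, ⟪z i, D (z i)⟫ = ‖z i‖ ^ 2 * ⟪y i, D (y i)⟫ := fun i => by
        have : z i = ‖z i‖ • y i := by
          rw [hy]
          simp only
          rw [smul_smul, mul_inv_cancel₀ (hzpos i).ne', one_smul]
        conv_lhs => rw [this, map_smul, inner_smul_left, inner_smul_right]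
        simp only [conj_trivial]
        ring
      simp only [h2] at h1
      rw [← h1]
      simp only [LinearMap.id_apply, real_inner_comm]
      simpa only [real_inner_comm] using htr
    have hF : frobSq b D = w * ∑ i, ⟪y i, D (y i)⟫ * (1 - ‖z i‖ ^ 2) := by
      rw [hF', ← sub_zero (w * ∑ i, ⟪y i, D (y i)⟫), ← hz0, ← mul_sub, ← Finset.sum_sub_distrib]
      congr 1
      exact Finset.sum_congr rfl fun i _ => by ring
    have hA := hQ D hDs htr
    have hB : w * ∑ i, (1 - ‖z i‖ ^ 2) ^ 2 ≤ 124 / 100 * frobSq b (frameError w x) := by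
      have h1 := sum_norm_apply_sq_le b hx (frameError_isSymmetric w x)
      have h2 : ∀ i, (1 - ‖z i‖ ^ 2) ^ 2 ≤ 1223 / 1000 * ‖frameError w x (x i)‖ ^ 2 := fun i => by
        have h3 : |1 - ‖z i‖| ≤ 11 / 20 * ‖frameError w x (x i)‖ := by
          refine le_trans ?_ (hdiff i)
          rw [← hn i, abs_sub_comm]
          exact abs_norm_sub_norm_le _ _
        have h4 : (1 - ‖z i‖) ^ 2 ≤ (11 / 20 * ‖frameError w x (x i)‖) ^ 2 := by
          rw [← sq_abs]
          exact pow_le_pow_left₀ (abs_nonneg _) h3 2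
        have h5 : (1 + ‖z i‖) ^ 2 ≤ (201 / 100) ^ 2 :=
          pow_le_pow_left₀ (by positivity) (by linarith [hzle i]) 2
        calc (1 - ‖z i‖ ^ 2) ^ 2 = (1 - ‖z i‖) ^ 2 * (1 + ‖z i‖) ^ 2 := by ring
          _ ≤ (11 / 20 * ‖frameError w x (x i)‖) ^ 2 * (201 / 100) ^ 2 := by gcongr
          _ ≤ _ := by nlinarith [sq_nonneg ‖frameError w x (x i)‖]
      have h6 := mul_le_mul_of_nonneg_left
        (Finset.sum_le_sum fun i (_ : i ∈ Finset.univ) => h2 i) hw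
      rw [← Finset.mul_sum, mul_left_comm] at h6
      have h7 := frobSq_nonneg b (frameError w x)
      nlinarith
    have hCS : frobSq b D ^ 2 ≤
        (w * ∑ i, ⟪y i, D (y i)⟫ ^ 2) * (w * ∑ i, (1 - ‖z i‖ ^ 2) ^ 2) := by
      rw [hF, mul_pow]
      have := Finset.sum_mul_sq_le_sq_mul_sq Finset.univ (fun i => ⟪y i, D (y i)⟫)
        (fun i => 1 - ‖z i‖ ^ 2)
      nlinarith [mul_le_mul_of_nonneg_left this (sq_nonneg w)]
    have hD0 := frobSq_nonneg b D
    have hx0 := frobSq_nonneg b (frameError w x)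
    have h8 : frobSq b D ^ 2 ≤
        ((39 / 50) ^ 2 * frobSq b D) * (124 / 100 * frobSq b (frameError w x)) :=
      hCS.trans (mul_le_mul hA hB (mul_nonneg hw (Finset.sum_nonneg fun _ _ => sq_nonneg _))
        (by positivity))
    -- Cancel one factor `frobSq b D`; `(39/50)² * 124/100` is about `0.754`, below `(9/10)²`.
    rcases hD0.eq_or_lt with h | h
    · rw [← h]; positivity
    · have : frobSq b D ≤ (39 / 50) ^ 2 * (124 / 100 * frobSq b (frameError w x)) := by
        by_contra! hcon
        nlinarith [mul_lt_mul_of_pos_left hcon h]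
      linarith

end SinkhornStep

/-! ### Convergence of the iteration to a balanced frame. -/

section SinkhornLimit

open Module Filter Topology
open scoped RealInnerProductSpace

variable {E : Type*} [NormedAddCommGroup E] [InnerProductSpace ℝ E]
variable {ι κ : Type*} [Fintype ι] [Fintype κ]

theorem frobSq_le_of_norm_le (b : OrthonormalBasis ι ℝ E) {X : E →ₗ[ℝ] E} {e : ℝ}
    (hX : ∀ v, ‖X v‖ ≤ e * ‖v‖) : frobSq b X ≤ Fintype.card ι * e ^ 2 := by
  have : ∀ a, ‖X (b a)‖ ^ 2 ≤ e ^ 2 := fun a => by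
    have := hX (b a)
    rw [b.norm_eq_one, mul_one] at this
    exact pow_le_pow_left₀ (norm_nonneg _) this 2
  refine (Finset.sum_le_sum fun a _ => this a).trans (le_of_eq ?_)
  simp

/-- The scaling iteration contracts the frame error geometrically while the vectors stay close to
their initial positions. -/
theorem exists_scaling_sequence [FiniteDimensional ℝ E] (b : OrthonormalBasis ι ℝ E) {w e t : ℝ}
    {x : κ → E} (hw : 0 ≤ w) (he0 : 0 ≤ e) (ht1 : 1 ≤ t) (ht : t ^ 6 = Fintype.card ι)
    (het : e * t ≤ 1 / 4000) (hn : ∀ i, ‖x i‖ = 1)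
    (hc : w * Fintype.card κ = Fintype.card ι) (hx : NearParseval w e x)
    (hQ : QuadBound b w (3 / 4) x) :
    ∃ y : ℕ → κ → E, y 0 = x ∧ (∀ k i, ‖y k i‖ = 1) ∧
      (∀ k, frobSq b (frameError w (y k)) ≤ ((9 / 10) ^ k) ^ 2 * frobSq b (frameError w x)) ∧
      ∀ k, w * ∑ i, ‖y (k + 1) i - y k i‖ ^ 2 ≤
        5 / 4 * (((9 / 10) ^ k) ^ 2 * frobSq b (frameError w x)) := by
  have he : e ≤ 1 / 100 := by nlinarith
  have hstep : ∀ s : {x : κ → E // (∀ i, ‖x i‖ = 1) ∧ NearParseval w e x},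
      ∃ s' : {x : κ → E // (∀ i, ‖x i‖ = 1) ∧ NearParseval w e x},
      (∀ i, ‖s'.1 i - s.1 i‖ ≤ 11 / 10 * ‖frameError w s.1 (s.1 i)‖) ∧
      (QuadBound b w (39 / 50) s'.1 →
        frobSq b (frameError w s'.1) ≤ (9 / 10) ^ 2 * frobSq b (frameError w s.1)) := by
    intro s
    obtain ⟨y, h1, h2, h3, h4⟩ := exists_scaling_step b hw he s.2.1 hc s.2.2
    exact ⟨⟨y, h1, h2⟩, h3, h4⟩
  choose f hf1 hf2 using hstep
  set s : ℕ → {x : κ → E // (∀ i, ‖x i‖ = 1) ∧ NearParseval w e x} :=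
    fun k => f^[k] ⟨x, hn, hx⟩ with hs
  have hs0 : (s 0).1 = x := rfl
  have hsucc : ∀ k, s (k + 1) = f (s k) := fun k => Function.iterate_succ_apply' f k _
  have hF0 : frobSq b (frameError w x) ≤ t ^ 6 * e ^ 2 := by
    rw [ht]
    exact frobSq_le_of_norm_le b (hx.norm_frameError_le he0)
  -- The two claims need each other: small total motion gives `QuadBound` at the next iterate and so
  -- the next contraction, while the decay so far bounds the motion.
  have hinv : ∀ k, frobSq b (frameError w (s k).1) ≤
      ((9 / 10) ^ k) ^ 2 * frobSq b (frameError w x) ∧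
      ∀ i, ‖(s k).1 i - x i‖ ≤ 11 / 10 * (e * t * ∑ j ∈ Finset.range k, (29 / 30) ^ j) := by
    intro k
    induction k with
    | zero => simp [hs0]
    | succ k ih =>
      obtain ⟨ih1, ih2⟩ := ih
      have hdist : ∀ i, ‖(s (k + 1)).1 i - x i‖ ≤
          11 / 10 * (e * t * ∑ j ∈ Finset.range (k + 1), (29 / 30) ^ j) := by
        intro i
        have h1 : ‖frameError w (s k).1 ((s k).1 i)‖ ≤ e := by
          have := (s k).2.2.norm_frameError_le he0 ((s k).1 i)
          rwa [(s k).2.1, mul_one] at this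
        have h2 : ‖frameError w (s k).1 ((s k).1 i)‖ ≤ e * ((29 / 30) ^ k * t) ^ 3 := by
          refine le_of_sq_le_sq ?_ (by positivity)
          have := norm_apply_sq_le b (frameError_isSymmetric w (s k).1) ((s k).1 i)
          rw [(s k).2.1, one_pow, mul_one] at this
          refine this.trans (ih1.trans ?_)
          have h9 : ((9 / 10 : ℝ) ^ k) ≤ ((29 / 30) ^ k) ^ 3 := by
            rw [← pow_mul, mul_comm k 3, pow_mul]
            exact pow_le_pow_left₀ (by norm_num) (by norm_num) k
          calc ((9 / 10 : ℝ) ^ k) ^ 2 * frobSq b (frameError w x)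
              ≤ (((29 / 30) ^ k) ^ 3) ^ 2 * (t ^ 6 * e ^ 2) := by
                gcongr
                exact frobSq_nonneg b _
            _ = _ := by ring
        -- With `c = (29/30)^k t`, the two bounds give `e * min 1 (c³) ≤ e * c`. The cube root of
        -- the decay rate, `29/30`, costs only one factor `t = d^{1/6}`, where the Frobenius bound
        -- alone would cost `t³ = √d`.
        have h3 : ‖frameError w (s k).1 ((s k).1 i)‖ ≤ e * ((29 / 30) ^ k * t) := by
          have h0 : (0 : ℝ) ≤ (29 / 30) ^ k * t := by positivity
          rcases le_total 1 ((29 / 30 : ℝ) ^ k * t) with h | h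
          · exact h1.trans (le_mul_of_one_le_right he0 h)
          · refine h2.trans (mul_le_mul_of_nonneg_left ?_ he0)
            exact pow_le_of_le_one h0 h (by norm_num)
        have h4 := hf1 (s k) i
        rw [← hsucc] at h4
        have h5 := norm_add_le ((s (k + 1)).1 i - (s k).1 i) ((s k).1 i - x i)
        rw [sub_add_sub_cancel] at h5
        rw [Finset.sum_range_succ]
        linarith [ih2 i]
      refine ⟨?_, hdist⟩
      have hsum : ∑ j ∈ Finset.range (k + 1), (29 / 30 : ℝ) ^ j ≤ 30 := by
        have h1 := geom_sum_eq (x := (29 / 30 : ℝ)) (by norm_num) (k + 1)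
        rw [h1]
        have : (0 : ℝ) ≤ (29 / 30) ^ (k + 1) := by positivity
        rw [div_le_iff_of_neg (by norm_num)]
        linarith
      -- The geometric series is at most `30`, and `11/10 * 30/4000 < 1/100`; this fixes the
      -- threshold `1/4000`.
      have hclose : ∀ i, ‖(s (k + 1)).1 i - x i‖ ≤ 1 / 100 := fun i => by
        refine (hdist i).trans ?_
        have : e * t * ∑ j ∈ Finset.range (k + 1), (29 / 30 : ℝ) ^ j ≤ 1 / 4000 * 30 := by
          gcongr
        linarith
      have hQ' := hQ.of_close hw he hx (s (k + 1)).2.2 hclose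
      have h6 := hf2 (s k)
      rw [← hsucc] at h6
      calc _ ≤ (9 / 10) ^ 2 * frobSq b (frameError w (s k).1) := h6 hQ'
        _ ≤ (9 / 10) ^ 2 * (((9 / 10) ^ k) ^ 2 * frobSq b (frameError w x)) := by gcongr
        _ = _ := by ring
  refine ⟨fun k => (s k).1, hs0, fun k => (s k).2.1, fun k => (hinv k).1, fun k => ?_⟩
  have h1 : ∀ i, ‖(s (k + 1)).1 i - (s k).1 i‖ ^ 2 ≤
      121 / 100 * ‖frameError w (s k).1 ((s k).1 i)‖ ^ 2 := fun i => by
    have h4 := hf1 (s k) i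
    rw [← hsucc] at h4
    refine (pow_le_pow_left₀ (norm_nonneg _) h4 2).trans (le_of_eq ?_)
    ring
  have h2 := mul_le_mul_of_nonneg_left (Finset.sum_le_sum fun i (_ : i ∈ Finset.univ) => h1 i) hw
  rw [← Finset.mul_sum, mul_left_comm] at h2
  have h3 := sum_norm_apply_sq_le b (s k).2.2 (frameError_isSymmetric w (s k).1)
  have h4 := frobSq_nonneg b (frameError w (s k).1)
  have h5 := (hinv k).1
  simp only
  nlinarith

/-- A nearly Parseval frame of unit vectors with a quadratic form bound is close to a balanced
frame, at a distance controlled by the frame error. -/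
theorem exists_balanced_frame [FiniteDimensional ℝ E] (b : OrthonormalBasis ι ℝ E) {w e t : ℝ}
    {x : κ → E} (hw : 0 < w) (he0 : 0 ≤ e) (ht1 : 1 ≤ t) (ht : t ^ 6 = Fintype.card ι)
    (het : e * t ≤ 1 / 4000) (hn : ∀ i, ‖x i‖ = 1)
    (hc : w * Fintype.card κ = Fintype.card ι) (hx : NearParseval w e x)
    (hQ : QuadBound b w (3 / 4) x) :
    ∃ y : κ → E, (∀ i, ‖y i‖ = 1) ∧ (∀ v, w * ∑ i, ⟪y i, v⟫ ^ 2 = ‖v‖ ^ 2) ∧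
      w * ∑ i, ‖x i - y i‖ ^ 2 ≤ 125 * frobSq b (frameError w x) := by
  obtain ⟨y, hy0, hyn, hyF, hyd⟩ := exists_scaling_sequence b hw.le he0 ht1 ht het hn hc hx hQ
  set F := frobSq b (frameError w x) with hF
  have hF0 : 0 ≤ F := frobSq_nonneg _ _
  set p : ℕ → PiLp 2 (fun _ : κ => E) := fun k => WithLp.toLp 2 (y k) with hp
  set C := Real.sqrt (5 / 4 * F / w) with hC
  have hC2 : C ^ 2 = 5 / 4 * F / w := Real.sq_sqrt (by positivity)
  have hC0 : 0 ≤ C := Real.sqrt_nonneg _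
  -- In the `ℓ²` sum of copies of `E` the steps are geometric, so the limit is within `10 C` of the
  -- start; `10² * 5/4` gives `125`.
  have hdist : ∀ k, dist (p k) (p (k + 1)) ≤ C * (9 / 10) ^ k := by
    intro k
    refine le_of_sq_le_sq ?_ (by positivity)
    rw [dist_comm, dist_eq_norm, PiLp.norm_sq_eq_of_L2, mul_pow, hC2, div_mul_eq_mul_div,
      le_div_iff₀ hw, mul_comm _ w]
    refine (hyd k).trans (le_of_eq ?_)
    ring
  obtain ⟨q, hq⟩ := cauchySeq_tendsto_of_complete
    (cauchySeq_of_le_geometric (9 / 10) C (by norm_num) hdist)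
  have hqi : ∀ i, Tendsto (fun k => y k i) atTop (𝓝 (q i)) := fun i =>
    ((PiLp.continuous_apply 2 (fun _ : κ => E) i).tendsto q).comp hq
  refine ⟨fun i => q i, fun i => ?_, fun v => ?_, ?_⟩
  · refine tendsto_nhds_unique ((hqi i).norm) ?_
    simp only [hyn]
    exact tendsto_const_nhds
  · have h1 : Tendsto (fun k => w * ∑ i, ⟪y k i, v⟫ ^ 2) atTop (𝓝 (w * ∑ i, ⟪q i, v⟫ ^ 2)) :=
      (tendsto_finsetSum _ fun i _ => ((hqi i).inner tendsto_const_nhds).pow 2).const_mul w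
    refine tendsto_nhds_unique h1 ?_
    rw [tendsto_iff_dist_tendsto_zero]
    have h2 : Tendsto (fun k : ℕ => Real.sqrt F * ‖v‖ ^ 2 * (9 / 10) ^ k) atTop (𝓝 0) := by
      have := (tendsto_pow_atTop_nhds_zero_of_lt_one (r := (9 / 10 : ℝ)) (by norm_num)
        (by norm_num)).const_mul (Real.sqrt F * ‖v‖ ^ 2)
      simpa using this
    refine squeeze_zero (fun _ => dist_nonneg) (fun k => ?_) h2
    rw [Real.dist_eq, ← inner_frameError_self]
    refine (abs_real_inner_le_norm _ _).trans ?_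
    have h3 : ‖frameError w (y k) v‖ ≤ (9 / 10) ^ k * Real.sqrt F * ‖v‖ := by
      refine le_of_sq_le_sq ?_ (by positivity)
      rw [mul_pow, mul_pow, Real.sq_sqrt hF0]
      exact (norm_apply_sq_le b (frameError_isSymmetric w (y k)) v).trans
        (mul_le_mul_of_nonneg_right (hyF k) (sq_nonneg _))
    nlinarith [mul_le_mul_of_nonneg_left h3 (norm_nonneg v)]
  · have h := dist_le_of_le_geometric_of_tendsto₀ (9 / 10) C (by norm_num) hdist hq
    have h2 : dist (p 0) q ≤ 10 * C := by
      refine h.trans (le_of_eq ?_)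
      ring
    have h3 := pow_le_pow_left₀ dist_nonneg h2 2
    rw [dist_eq_norm, PiLp.norm_sq_eq_of_L2, mul_pow, hC2] at h3
    have h4 : ∀ i, (p 0 - q) i = x i - q i := fun i => by
      simp [hp, hy0]
    simp only [h4] at h3
    calc _ ≤ w * (10 ^ 2 * (5 / 4 * F / w)) := mul_le_mul_of_nonneg_left h3 hw.le
      _ = 125 * F := by field_simp; ring

end SinkhornLimit

/-! ### Rotation invariance of the uniform measure. -/

section UniformSphere

open Module Set
open scoped RealInnerProductSpace Pointwise

variable {d : ℕ}

theorem isProbabilityMeasure_uniformSphere (hd : 1 ≤ d) (r : ℝ) :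
    IsProbabilityMeasure (uniformSphere d r) := by
  have : Nontrivial (EuclideanSpace ℝ (Fin d)) := by
    have : Nonempty (Fin d) := ⟨⟨0, hd⟩⟩
    infer_instance
  have : IsProbabilityMeasure (((volume : Measure (EuclideanSpace ℝ (Fin d))).toSphere univ)⁻¹ •
      (volume : Measure (EuclideanSpace ℝ (Fin d))).toSphere) := by
    refine ⟨?_⟩
    rw [Measure.smul_apply, smul_eq_mul]
    refine ENNReal.inv_mul_cancel ?_ (measure_ne_top _ _)
    rw [Ne, Measure.measure_univ_eq_zero]
    exact Measure.toSphere_ne_zero _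
  exact Measure.isProbabilityMeasure_map (Measurable.aemeasurable (by fun_prop))

theorem map_smul_uniformSphere (r : ℝ) :
    (uniformSphere d 1).map (fun x => r • x) = uniformSphere d r := by
  rw [uniformSphere, uniformSphere, Measure.map_map (by fun_prop) (by fun_prop)]
  congr 1
  funext x
  simp

theorem norm_eq_one_ae_uniformSphere : ∀ᵐ x ∂uniformSphere d 1, ‖x‖ = 1 := by
  rw [uniformSphere, ae_map_iff (Measurable.aemeasurable (by fun_prop))
    (measurableSet_eq_fun (by fun_prop) (by fun_prop))]
  refine Filter.Eventually.of_forall fun x => ?_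
  simp

/-- The surface measure of a set is a multiple of the volume of the cone over it, and linear
isometries preserve volume. -/
theorem map_isometry_uniformSphere
    (L : EuclideanSpace ℝ (Fin d) ≃ₗᵢ[ℝ] EuclideanSpace ℝ (Fin d)) :
    (uniformSphere d 1).map L = uniformSphere d 1 := by
  set E := EuclideanSpace ℝ (Fin d)
  let g : Metric.sphere (0 : E) 1 → Metric.sphere (0 : E) 1 := fun x => ⟨L x, by simp⟩
  have hg : Measurable g := by
    refine Measurable.subtype_mk ?_
    exact L.continuous.measurable.comp measurable_subtype_coe
  have hinv : ((volume : Measure E).toSphere).map g = (volume : Measure E).toSphere := by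
    refine Measure.ext fun s hs => ?_
    rw [Measure.map_apply hg hs, Measure.toSphere_apply' _ hs, Measure.toSphere_apply' _ (hg hs)]
    congr 1
    rw [← L.measurePreserving.measure_preimage_equiv (f := L.toMeasurableEquiv)
      (Ioo (0 : ℝ) 1 • ((↑) '' s : Set E))]
    congr 1
    ext v
    simp only [mem_smul, mem_image, mem_preimage]
    constructor
    · rintro ⟨c, hc, _, ⟨y, hy, rfl⟩, rfl⟩
      exact ⟨c, hc, _, ⟨g y, hy, rfl⟩, by simp [g]⟩
    · rintro ⟨c, hc, _, ⟨y, hy, rfl⟩, h⟩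
      have hy1 : (L.symm (y : E)) ∈ Metric.sphere (0 : E) 1 := by
        rw [mem_sphere_zero_iff_norm, L.symm.norm_map]
        exact norm_eq_of_mem_sphere y
      refine ⟨c, hc, L.symm y, ⟨⟨L.symm y, hy1⟩, ?_, rfl⟩, ?_⟩
      · have : g ⟨L.symm y, hy1⟩ = y := by ext1; simp [g]
        rwa [this]
      · apply L.injective
        simpa using h
  have hinv' : ((((volume : Measure E).toSphere univ)⁻¹ • (volume : Measure E).toSphere).map g) =
      ((volume : Measure E).toSphere univ)⁻¹ • (volume : Measure E).toSphere := by
    rw [Measure.map_smul, hinv]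
  calc (uniformSphere d 1).map L
      = (((volume : Measure E).toSphere univ)⁻¹ • (volume : Measure E).toSphere).map
          (fun x => (1 : ℝ) • (g x : E)) := by
        rw [uniformSphere, Measure.map_map (by fun_prop) (by fun_prop)]
        congr 1
        funext x
        simp [g]
    _ = uniformSphere d 1 := by
        conv_rhs => rw [uniformSphere]
        change _ = Measure.map _ (((volume : Measure E).toSphere univ)⁻¹ •
          (volume : Measure E).toSphere)
        conv_rhs => rw [← hinv']
        rw [Measure.map_map (by fun_prop) hg]
        rfl

end UniformSphere

/-! ### Moments of a coordinate, from rotation invariance alone. -/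

section SphereMoments

open Module Set
open scoped RealInnerProductSpace

variable {d : ℕ}

theorem integrable_uniformSphere (hd : 1 ≤ d) {f : EuclideanSpace ℝ (Fin d) → ℝ}
    (hf : Continuous f) : Integrable f (uniformSphere d 1) := by
  have := isProbabilityMeasure_uniformSphere hd 1
  obtain ⟨C, hC⟩ := (isCompact_closedBall (0 : EuclideanSpace ℝ (Fin d))
    1).exists_bound_of_continuousOn hf.continuousOn
  refine Integrable.of_bound hf.aestronglyMeasurable C ?_
  filter_upwards [norm_eq_one_ae_uniformSphere] with x hx
  exact hC x (by simp [hx])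

/-- The reflection in the hyperplane orthogonal to `u - v` exchanges `u` and `v`. -/
theorem integral_inner_pow_congr {u v : EuclideanSpace ℝ (Fin d)} (h : ‖u‖ = ‖v‖) (k : ℕ) :
    ∫ x, ⟪x, u⟫ ^ k ∂uniformSphere d 1 = ∫ x, ⟪x, v⟫ ^ k ∂uniformSphere d 1 := by
  set L := (ℝ ∙ (u - v))ᗮ.reflection
  have hL : L u = v := Submodule.reflection_sub h
  conv_lhs => rw [← map_isometry_uniformSphere L.symm]
  rw [integral_map L.symm.continuous.measurable.aemeasurable (by fun_prop)]
  congr 1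
  funext x
  rw [← L.inner_map_map, L.apply_symm_apply, hL]

/-- The even moments of a coordinate of a uniform point of the unit sphere. -/
noncomputable def sphereMoment (d k : ℕ) (hd : 1 ≤ d) : ℝ :=
  ∫ x, ⟪x, EuclideanSpace.basisFun (Fin d) ℝ ⟨0, hd⟩⟫ ^ (2 * k) ∂uniformSphere d 1

theorem integral_inner_pow (hd : 1 ≤ d) (v : EuclideanSpace ℝ (Fin d)) (k : ℕ) :
    ∫ x, ⟪x, v⟫ ^ (2 * k) ∂uniformSphere d 1 = sphereMoment d k hd * ‖v‖ ^ (2 * k) := by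
  set e := EuclideanSpace.basisFun (Fin d) ℝ ⟨0, hd⟩ with he
  have h : ‖v‖ = ‖‖v‖ • e‖ := by rw [norm_smul, OrthonormalBasis.norm_eq_one]; simp
  rw [integral_inner_pow_congr h]
  simp only [inner_smul_right, mul_pow]
  rw [integral_const_mul, mul_comm]
  rfl

theorem sphereMoment_nonneg (k : ℕ) (hd : 1 ≤ d) : 0 ≤ sphereMoment d k hd :=
  integral_nonneg fun _ => (even_two_mul k).pow_nonneg _

theorem sphereMoment_zero (hd : 1 ≤ d) : sphereMoment d 0 hd = 1 := by
  have := isProbabilityMeasure_uniformSphere hd 1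
  simp [sphereMoment]

/-- Both sides of `∫ ⟪x, e + s f⟫^(2k+2) = m (1 + s²)^(k+1)` are polynomials in `s`; compare the
coefficients of `s²` and divide by `k + 1`. -/
theorem integral_inner_pow_mul_inner_sq (hd : 1 ≤ d) {e f : EuclideanSpace ℝ (Fin d)}
    (he : ‖e‖ = 1) (hf : ‖f‖ = 1) (hef : ⟪e, f⟫ = 0) (k : ℕ) :
    (2 * k + 1) * ∫ x, ⟪x, e⟫ ^ (2 * k) * ⟪x, f⟫ ^ 2 ∂uniformSphere d 1 =
      sphereMoment d (k + 1) hd := by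
  set m := sphereMoment d (k + 1) hd
  set I : ℕ → ℝ := fun j => ∫ x, ⟪x, f⟫ ^ j * ⟪x, e⟫ ^ (2 * (k + 1) - j) ∂uniformSphere d 1
  set p : Polynomial ℝ := ∑ j ∈ Finset.range (2 * (k + 1) + 1),
    Polynomial.monomial j (I j * (2 * (k + 1)).choose j) with hp
  set q : Polynomial ℝ := Polynomial.C m * Polynomial.expand ℝ 2 ((1 + Polynomial.X) ^ (k + 1))
    with hq
  have hpq : p = q := by
    refine Polynomial.funext fun s => ?_
    have h1 : p.eval s = ∫ x, ⟪x, e + s • f⟫ ^ (2 * (k + 1)) ∂uniformSphere d 1 := by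
      have : ∀ x : EuclideanSpace ℝ (Fin d), ⟪x, e + s • f⟫ ^ (2 * (k + 1)) =
          ∑ j ∈ Finset.range (2 * (k + 1) + 1), (s ^ j * (2 * (k + 1)).choose j) *
            (⟪x, f⟫ ^ j * ⟪x, e⟫ ^ (2 * (k + 1) - j)) := fun x => by
        rw [inner_add_right, inner_smul_right, add_comm, add_pow]
        refine Finset.sum_congr rfl fun j _ => ?_
        rw [mul_pow]
        ring
      simp only [this]
      rw [integral_finsetSum _ fun j _ => integrable_uniformSphere hd (by fun_prop)]
      simp only [integral_const_mul, hp, Polynomial.eval_finsetSum, Polynomial.eval_monomial]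
      refine Finset.sum_congr rfl fun j _ => ?_
      simp only [I]
      ring
    have h2 : ‖e + s • f‖ ^ 2 = 1 + s ^ 2 := by
      rw [norm_add_sq_real, inner_smul_right, hef, norm_smul, he, hf]
      simp
    rw [h1, integral_inner_pow hd, pow_mul, h2, hq]
    simp [m]
  have h3 := congrArg (fun r => r.coeff 2) hpq
  have h4 : p.coeff 2 = I 2 * (2 * (k + 1)).choose 2 := by
    simp [hp, Polynomial.coeff_monomial]
  have h5 : q.coeff 2 = m * (k + 1) := by
    rw [hq, Polynomial.coeff_C_mul]
    have := Polynomial.coeff_expand_mul (R := ℝ) (p := 2) (by norm_num) 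
      ((1 + Polynomial.X) ^ (k + 1)) 1
    rw [one_mul] at this
    rw [this, Polynomial.coeff_one_add_X_pow]
    simp
  simp only [h4, h5] at h3
  rw [Nat.cast_choose_two] at h3
  have h6 : I 2 = ∫ x, ⟪x, e⟫ ^ (2 * k) * ⟪x, f⟫ ^ 2 ∂uniformSphere d 1 := by
    simp only [I]
    congr 1
    funext x
    rw [mul_comm]
    congr 2
  rw [← h6]
  have h7 : (k : ℝ) + 1 ≠ 0 := by positivity
  push_cast at h3
  refine mul_right_cancel₀ h7 ?_
  linear_combination h3

/-- Insert `1 = ∑ ⟪x, b j⟫²` into the moment of order `2k`: one term is the next moment, and each of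
the other `d - 1` is that moment divided by `2k + 1`. -/
theorem sphereMoment_succ (hd : 1 ≤ d) (k : ℕ) :
    (d + 2 * k) * sphereMoment d (k + 1) hd = (2 * k + 1) * sphereMoment d k hd := by
  set b := EuclideanSpace.basisFun (Fin d) ℝ with hb
  have h1 : sphereMoment d k hd =
      ∑ j, ∫ x, ⟪x, b ⟨0, hd⟩⟫ ^ (2 * k) * ⟪x, b j⟫ ^ 2 ∂uniformSphere d 1 := by
    rw [← integral_finsetSum _ fun j _ => integrable_uniformSphere hd (by fun_prop)]
    refine integral_congr_ae ?_
    filter_upwards [norm_eq_one_ae_uniformSphere] with x hx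
    rw [← Finset.mul_sum]
    simp only [real_inner_comm _ x]
    rw [sum_inner_sq_eq b, hx, one_pow, mul_one]
  have h2 : ∀ j, j ≠ ⟨0, hd⟩ → (2 * k + 1) *
      ∫ x, ⟪x, b ⟨0, hd⟩⟫ ^ (2 * k) * ⟪x, b j⟫ ^ 2 ∂uniformSphere d 1 =
        sphereMoment d (k + 1) hd := fun j hj =>
    integral_inner_pow_mul_inner_sq hd (b.norm_eq_one _) (b.norm_eq_one _)
      (b.orthonormal.2 hj.symm) k
  have h3 : ∫ x, ⟪x, b ⟨0, hd⟩⟫ ^ (2 * k) * ⟪x, b ⟨0, hd⟩⟫ ^ 2 ∂uniformSphere d 1 =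
      sphereMoment d (k + 1) hd := by
    simp only [← pow_add]
    rfl
  rw [h1, Finset.mul_sum, ← Finset.add_sum_erase _ _ (Finset.mem_univ (⟨0, hd⟩ : Fin d)), h3,
    Finset.sum_congr rfl fun j hj => h2 j (Finset.ne_of_mem_erase hj)]
  simp [Finset.card_erase_of_mem, Nat.cast_sub hd]
  ring

end SphereMoments

/-! ### Quadratic forms and exponential moments on the sphere. -/

section SphereQuadraticForms

open Module Set
open scoped RealInnerProductSpace

theorem frobSq_eq_frobSq {E ι κ : Type*} [NormedAddCommGroup E] [InnerProductSpace ℝ E]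
    [Fintype ι] [Fintype κ] (b : OrthonormalBasis ι ℝ E) (c : OrthonormalBasis κ ℝ E)
    {X : E →ₗ[ℝ] E} (hX : X.IsSymmetric) : frobSq b X = frobSq c X := by
  simp only [frobSq]
  calc ∑ j, ‖X (b j)‖ ^ 2 = ∑ j, ∑ k, ⟪c k, X (b j)⟫ ^ 2 := by simp only [sum_inner_sq_eq]
    _ = ∑ k, ∑ j, ⟪b j, X (c k)⟫ ^ 2 := by
      rw [Finset.sum_comm]
      simp only [← hX (c _), real_inner_comm]
    _ = _ := by simp only [sum_inner_sq_eq]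

variable {d : ℕ}

theorem sphereMoment_two (hd : 1 ≤ d) : sphereMoment d 2 hd = 3 / (d * (d + 2)) := by
  have h0 := sphereMoment_succ hd 0
  have h1 := sphereMoment_succ hd 1
  rw [sphereMoment_zero] at h0
  have : (0 : ℝ) < d := by exact_mod_cast hd
  norm_num at h0 h1
  rw [eq_div_iff (by positivity)]
  linear_combination d * h1 + 3 * h0

/-- Diagonalize `X`. The mixed fourth moments are `1 / (d (d + 2))`, tripled on the diagonal, so the
integral is `((∑ l)² + 2 ∑ l²) / (d (d + 2))`, and the trace term vanishes. -/
theorem integral_inner_apply_sq (hd : 1 ≤ d) {ι : Type*} [Fintype ι]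
    (b : OrthonormalBasis ι ℝ (EuclideanSpace ℝ (Fin d)))
    {X : EuclideanSpace ℝ (Fin d) →ₗ[ℝ] EuclideanSpace ℝ (Fin d)} (hX : X.IsSymmetric)
    (htr : ∑ a, ⟪b a, X (b a)⟫ = 0) :
    ∫ x, ⟪x, X x⟫ ^ 2 ∂uniformSphere d 1 = 2 / (d * (d + 2)) * frobSq b X := by
  set c := hX.eigenvectorBasis rfl
  set l := hX.eigenvalues rfl
  have hc : ∀ k, X (c k) = l k • c k := fun k => hX.apply_eigenvectorBasis rfl k
  have hl : ∑ k, l k = 0 := by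
    rw [← htr, ← LinearMap.trace_eq_sum_inner X b, LinearMap.trace_eq_sum_inner X c]
    simp [hc, inner_smul_right]
  have hF : frobSq b X = ∑ k, l k ^ 2 := by
    rw [frobSq_eq_frobSq b c hX, frobSq]
    simp [hc, norm_smul]
  have hq : ∀ x, ⟪x, X x⟫ ^ 2 = ∑ k, ∑ j, l k * l j * (⟪x, c k⟫ ^ 2 * ⟪x, c j⟫ ^ 2) := by
    intro x
    have : ⟪x, X x⟫ = ∑ k, l k * ⟪x, c k⟫ ^ 2 := by
      rw [← c.sum_inner_mul_inner x (X x)]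
      refine Finset.sum_congr rfl fun k _ => ?_
      rw [← hX, hc, inner_smul_left, real_inner_comm x (c k)]
      simp only [conj_trivial]
      ring
    rw [this, sq, Finset.sum_mul_sum]
    exact Finset.sum_congr rfl fun k _ => Finset.sum_congr rfl fun j _ => by ring
  have hm : ∀ k j, ∫ x, ⟪x, c k⟫ ^ 2 * ⟪x, c j⟫ ^ 2 ∂uniformSphere d 1 =
      1 / (d * (d + 2)) * (1 + if k = j then 2 else 0) := by
    intro k j
    split_ifs with h
    · subst h
      simp only [← pow_add]
      have := integral_inner_pow hd (c k) 2
      rw [c.norm_eq_one, one_pow, mul_one, sphereMoment_two] at this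
      refine this.trans ?_
      ring
    · have := integral_inner_pow_mul_inner_sq hd (c.norm_eq_one k) (c.norm_eq_one j)
        (c.orthonormal.2 h) 1
      rw [sphereMoment_two] at this
      simp only [mul_one, Nat.cast_one] at this
      linear_combination this / 3
  simp only [hq]
  rw [integral_finsetSum _ fun k _ => integrable_uniformSphere hd (by fun_prop)]
  have hI : ∀ k, ∫ x, ∑ j, l k * l j * (⟪x, c k⟫ ^ 2 * ⟪x, c j⟫ ^ 2) ∂uniformSphere d 1 =
      ∑ j, ∫ x, l k * l j * (⟪x, c k⟫ ^ 2 * ⟪x, c j⟫ ^ 2) ∂uniformSphere d 1 := fun k =>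
    integral_finsetSum _ fun j _ => integrable_uniformSphere hd (by fun_prop)
  simp only [hI, integral_const_mul, hm, hF]
  have e1 : ∀ k, ∑ j, l k * l j * (1 / ((d : ℝ) * (d + 2)) * (1 + if k = j then 2 else 0)) =
      1 / (d * (d + 2)) * (l k * ∑ j, l j + 2 * l k ^ 2) := by
    intro k
    have : ∀ j, l k * l j * (1 / ((d : ℝ) * (d + 2)) * (1 + if k = j then 2 else 0)) =
        1 / (d * (d + 2)) * (l k * l j) +
          if k = j then 1 / ((d : ℝ) * (d + 2)) * (2 * l k ^ 2) else 0 := by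
      intro j
      split_ifs with h
      · subst h; ring
      · ring
    simp only [this, Finset.sum_add_distrib, ← Finset.mul_sum, Finset.sum_ite_eq, Finset.mem_univ,
      if_true]
    ring
  simp only [e1, hl, mul_zero, zero_add, ← Finset.mul_sum]
  ring

/-- The traceless part of `x xᵀ`, for a unit vector `x`. -/
noncomputable def tracelessSquare (x : EuclideanSpace ℝ (Fin d)) (p : Fin d × Fin d) : ℝ :=
  x p.1 * x p.2 - if p.1 = p.2 then 1 / (d : ℝ) else 0

theorem continuous_tracelessSquare (p : Fin d × Fin d) :
    Continuous fun x : EuclideanSpace ℝ (Fin d) => tracelessSquare x p := by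
  unfold tracelessSquare
  fun_prop

theorem sum_tracelessSquare_sq_le {x : EuclideanSpace ℝ (Fin d)} (hx : ‖x‖ = 1) :
    ∑ p, tracelessSquare x p ^ 2 ≤ 1 := by
  have h1 : ∑ a, x a ^ 2 = 1 := by
    rw [← EuclideanSpace.real_norm_sq_eq, hx, one_pow]
  have : ∀ p : Fin d × Fin d, tracelessSquare x p ^ 2 = x p.1 ^ 2 * x p.2 ^ 2 +
      if p.1 = p.2 then (1 / (d : ℝ)) ^ 2 - 2 * (1 / d) * x p.1 ^ 2 else 0 := by
    rintro ⟨a, b⟩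
    simp only [tracelessSquare]
    split_ifs with h
    · subst h; ring
    · ring
  simp only [this, Finset.sum_add_distrib, Fintype.sum_prod_type, ← Finset.mul_sum,
    Finset.sum_ite_eq, Finset.mem_univ, if_true, h1, Finset.sum_sub_distrib, mul_one]
  rcases Nat.eq_zero_or_pos d with h | h
  · subst h; simp at h1
  · have : (0 : ℝ) < d := by exact_mod_cast h
    have h2 : 0 < 1 / (d : ℝ) := by positivity
    have h3 : (d : ℝ) * (1 / d) ^ 2 = 1 / d := by field_simp
    simp only [Finset.sum_const, Finset.card_univ, Fintype.card_fin, nsmul_eq_mul]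
    rw [h3]
    linarith

/-- A general coefficient array acts only through its symmetric traceless part, and projecting to
that part does not increase the norm. This is the covariance bound fed into the fourth moment
estimate. -/
theorem integral_tracelessSquare_sq_le (hd : 1 ≤ d) (v : Fin d × Fin d → ℝ) :
    ∫ x, (∑ p, v p * tracelessSquare x p) ^ 2 ∂uniformSphere d 1 ≤
      2 / (d * (d + 2)) * ∑ p, v p ^ 2 := by
  set t := ∑ a, v (a, a) with ht
  have hd0 : (0 : ℝ) < d := by exact_mod_cast hd
  set M : Matrix (Fin d) (Fin d) ℝ := Matrix.of fun a b =>
    (v (a, b) + v (b, a)) / 2 - if a = b then t / d else 0 with hM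
  set X := Matrix.toEuclideanLin M with hXdef
  have hX : X.IsSymmetric := by
    rw [Matrix.isSymmetric_toEuclideanLin_iff]
    ext a b
    simp only [hM, Matrix.conjTranspose_apply, Matrix.of_apply, star_trivial, eq_comm (a := a),
      add_comm]
  set e := EuclideanSpace.basisFun (Fin d) ℝ
  have hXe : ∀ a b, X (e b) a = M a b := by
    intro a b
    simp [hXdef, e, Matrix.toLpLin_apply]
  have htr : ∑ a, ⟪e a, X (e a)⟫ = 0 := by
    have : ∀ a, ⟪e a, X (e a)⟫ = M a a := fun a => by
      rw [← hXe, ← e.repr_apply_apply]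
      simp [e]
    simp only [this, hM, Matrix.of_apply, if_true, Finset.sum_sub_distrib, add_self_div_two]
    rw [← ht]
    simp
    field_simp
    ring
  have hF : frobSq e X ≤ ∑ p, v p ^ 2 := by
    have h1 : frobSq e X = ∑ a, ∑ b, M a b ^ 2 := by
      rw [frobSq, Finset.sum_comm]
      refine Finset.sum_congr rfl fun b _ => ?_
      rw [EuclideanSpace.real_norm_sq_eq]
      simp only [hXe]
    have h2 : ∀ a b, M a b ^ 2 = ((v (a, b) + v (b, a)) / 2) ^ 2 +
        if a = b then (t / d) ^ 2 - 2 * (t / d) * v (a, a) else 0 := by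
      intro a b
      simp only [hM, Matrix.of_apply]
      split_ifs with h
      · subst h; ring
      · ring
    have h3 : ∑ a, ∑ b, ((v (a, b) + v (b, a)) / 2) ^ 2 ≤
        ∑ a, ∑ b, (v (a, b) ^ 2 + v (b, a) ^ 2) / 2 :=
      Finset.sum_le_sum fun a _ => Finset.sum_le_sum fun b _ => by
        nlinarith [sq_nonneg (v (a, b) - v (b, a))]
    have h4 : ∑ a, ∑ b, (v (a, b) ^ 2 + v (b, a) ^ 2) / 2 = ∑ p, v p ^ 2 := by
      simp only [← Finset.sum_div, Finset.sum_add_distrib, Fintype.sum_prod_type]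
      rw [Finset.sum_comm (f := fun a b => v (b, a) ^ 2)]
      ring
    rw [h1]
    simp only [h2, Finset.sum_add_distrib, Finset.sum_ite_eq, Finset.mem_univ, if_true,
      Finset.sum_sub_distrib, ← Finset.mul_sum]
    rw [← ht, ← h4]
    have h5 : ∑ _a : Fin d, (t / d) ^ 2 - 2 * (t / d) * t = - (t ^ 2 / d) := by
      simp
      field_simp
      ring
    have h6 : 0 ≤ t ^ 2 / d := by positivity
    linarith
  have hint : ∫ x, (∑ p, v p * tracelessSquare x p) ^ 2 ∂uniformSphere d 1 =
      ∫ x, ⟪x, X x⟫ ^ 2 ∂uniformSphere d 1 := by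
    refine integral_congr_ae ?_
    filter_upwards [norm_eq_one_ae_uniformSphere] with x hx
    have h1 : ∑ a, x a ^ 2 = 1 := by
      rw [← EuclideanSpace.real_norm_sq_eq, hx, one_pow]
    congr 1
    have h2 : ⟪x, X x⟫ = ∑ a, ∑ b, x a * M a b * x b := by
      simp only [PiLp.inner_apply, hXdef, Matrix.toLpLin_apply, Matrix.mulVec, dotProduct]
      refine Finset.sum_congr rfl fun a _ => ?_
      simp only [RCLike.inner_apply, conj_trivial]
      rw [Finset.sum_mul]
      exact Finset.sum_congr rfl fun b _ => by ring
    have h3 : ∀ a b, x a * M a b * x b = (x a * x b * v (a, b) + x b * x a * v (b, a)) / 2 -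
        if a = b then t / d * x a ^ 2 else 0 := by
      intro a b
      simp only [hM, Matrix.of_apply]
      split_ifs with h
      · subst h; ring
      · ring
    have h4 : ∀ a b, v (a, b) * tracelessSquare x (a, b) = x a * x b * v (a, b) -
        if a = b then 1 / d * v (a, a) else 0 := by
      intro a b
      simp only [tracelessSquare]
      split_ifs with h
      · subst h; ring
      · ring
    rw [h2, Fintype.sum_prod_type]
    simp only [h3, h4, Finset.sum_sub_distrib, Finset.sum_ite_eq, Finset.mem_univ, if_true,
      ← Finset.mul_sum, h1, ← Finset.sum_div, Finset.sum_add_distrib, ← ht]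
    rw [Finset.sum_comm (f := fun a b => x b * x a * v (b, a))]
    ring
  rw [hint, integral_inner_apply_sq hd e hX htr]
  exact mul_le_mul_of_nonneg_left hF (by positivity)

theorem sphereMoment_le (hd : 1 ≤ d) (k : ℕ) :
    (d : ℝ) ^ k * sphereMoment d k hd ≤ 2 ^ k * k.factorial := by
  induction k with
  | zero => simp [sphereMoment_zero]
  | succ k ih =>
    have h := sphereMoment_succ hd k
    have h0 := sphereMoment_nonneg (d := d) (k + 1) hd
    have h1 := sphereMoment_nonneg (d := d) k hd
    have hd0 : (0 : ℝ) < d := by exact_mod_cast hd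
    have h2 : d * sphereMoment d (k + 1) hd ≤ 2 * (k + 1) * sphereMoment d k hd := by
      nlinarith [mul_nonneg (Nat.cast_nonneg (α := ℝ) k) h0]
    calc (d : ℝ) ^ (k + 1) * sphereMoment d (k + 1) hd
        = d ^ k * (d * sphereMoment d (k + 1) hd) := by ring
      _ ≤ d ^ k * (2 * (k + 1) * sphereMoment d k hd) := by gcongr
      _ = 2 * (k + 1) * (d ^ k * sphereMoment d k hd) := by ring
      _ ≤ 2 * (k + 1) * (2 ^ k * k.factorial) := by gcongr
      _ = _ := by rw [Nat.factorial_succ]; push_cast; ring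

/-- Integrate the exponential series termwise: by `sphereMoment_le` the `k`-th term is at most
`2^{-k}`. -/
theorem integral_exp_inner_sq_le (hd : 1 ≤ d) {v : EuclideanSpace ℝ (Fin d)} (hv : ‖v‖ = 1) :
    ∫ x, Real.exp (d * ⟪x, v⟫ ^ 2 / 4) ∂uniformSphere d 1 ≤ 2 := by
  set F : ℕ → EuclideanSpace ℝ (Fin d) → ℝ := fun k x =>
    (d * ⟪x, v⟫ ^ 2 / 4) ^ k / k.factorial with hF
  have hFi : ∀ k, Integrable (F k) (uniformSphere d 1) := fun k =>
    integrable_uniformSphere hd (by fun_prop)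
  have hF0 : ∀ k x, 0 ≤ F k x := fun k x => by positivity
  have hFint : ∀ k, ∫ x, F k x ∂uniformSphere d 1 ≤ (1 / 2) ^ k := by
    intro k
    have : ∀ x, F k x = (1 / 4 : ℝ) ^ k / k.factorial * d ^ k * ⟪x, v⟫ ^ (2 * k) := fun x => by
      simp only [hF]
      rw [div_eq_mul_one_div _ (4 : ℝ), mul_pow, mul_pow, ← pow_mul]
      ring
    simp only [this]
    rw [integral_const_mul, integral_inner_pow hd, hv, one_pow, mul_one, mul_assoc]
    refine (mul_le_mul_of_nonneg_left (sphereMoment_le hd k) (by positivity)).trans (le_of_eq ?_)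
    have : (k.factorial : ℝ) ≠ 0 := by positivity
    field_simp
    rw [← mul_pow]
    norm_num
  have hsum : Summable fun k => ∫ x, ‖F k x‖ ∂uniformSphere d 1 := by
    refine Summable.of_nonneg_of_le (fun k => integral_nonneg fun _ => norm_nonneg _) (fun k => ?_)
      (summable_geometric_of_lt_one (r := (1 / 2 : ℝ)) (by norm_num) (by norm_num))
    simp only [Real.norm_eq_abs, abs_of_nonneg (hF0 _ _)]
    exact hFint k
  have h := hasSum_integral_of_summable_integral_norm hFi hsum
  have he : ∀ x, ∑' k, F k x = Real.exp (d * ⟪x, v⟫ ^ 2 / 4) := fun x => by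
    rw [Real.exp_eq_exp_ℝ, NormedSpace.exp_eq_tsum_div]
  simp only [he] at h
  refine hasSum_le hFint h ?_
  exact hasSum_geometric_two

end SphereQuadraticForms

/-! ### Fourth moments of sums of independent symmetric matrices. -/

section RandomMatrices

variable {ι κ : Type*}

/-- Matrices carry the product measurable structure. -/
instance Matrix.instMeasurableSpacePi : MeasurableSpace (Matrix ι ι ℝ) :=
  inferInstanceAs (MeasurableSpace (ι → ι → ℝ))

instance Matrix.instMeasurableAddPi : MeasurableAdd₂ (Matrix ι ι ℝ) :=
  inferInstanceAs (MeasurableAdd₂ (ι → ι → ℝ))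

theorem Matrix.measurable_apply (a b : ι) : Measurable fun A : Matrix ι ι ℝ => A a b :=
  (measurable_pi_apply b).comp (measurable_pi_apply (X := fun _ : ι => ι → ℝ) a)

theorem Matrix.measurable_of_apply {α : Type*} [MeasurableSpace α] {f : α → Matrix ι ι ℝ}
    (hf : ∀ a b, Measurable fun x => f x a b) : Measurable f :=
  measurable_pi_lambda (X := fun _ : ι => ι → ℝ) f fun a => measurable_pi_lambda _ fun b => hf a b

variable {Ω : Type*} [MeasurableSpace Ω] {P : Measure Ω}

/-- A random matrix with essentially bounded entries. -/
def BoundedEntries (P : Measure Ω) (A : Ω → Matrix ι ι ℝ) : Prop :=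
  ∀ a b, MemLp (fun ω => A ω a b) ⊤ P

theorem BoundedEntries.add {A B : Ω → Matrix ι ι ℝ} (hA : BoundedEntries P A)
    (hB : BoundedEntries P B) : BoundedEntries P fun ω => A ω + B ω :=
  fun a b => (hA a b).add (hB a b)

theorem BoundedEntries.sum {Z : κ → Ω → Matrix ι ι ℝ} (hZ : ∀ i, BoundedEntries P (Z i))
    (s : Finset κ) : BoundedEntries P fun ω => ∑ i ∈ s, Z i ω := by
  intro a b
  simp only [Matrix.sum_apply]
  exact memLp_finsetSum _ fun i _ => hZ i a b

/-- The entrywise expectation. -/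
noncomputable def expMatrix (P : Measure Ω) (A : Ω → Matrix ι ι ℝ) : Matrix ι ι ℝ :=
  Matrix.of fun a b => ∫ ω, A ω a b ∂P

variable [Fintype ι]

theorem Matrix.trace_mul_self_nonneg {A : Matrix ι ι ℝ} (hA : A.IsSymm) : 0 ≤ (A * A).trace := by
  simp only [Matrix.trace, Matrix.diag, Matrix.mul_apply]
  exact Finset.sum_nonneg fun a _ => Finset.sum_nonneg fun b _ => by
    rw [hA.apply a b]; exact mul_self_nonneg _

theorem Matrix.trace_transpose_mul_self_nonneg (A : Matrix ι ι ℝ) :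
    0 ≤ (A.transpose * A).trace := by
  simp only [Matrix.trace, Matrix.diag, Matrix.mul_apply, Matrix.transpose_apply]
  exact Finset.sum_nonneg fun a _ => Finset.sum_nonneg fun b _ => mul_self_nonneg _

theorem Matrix.trace_add_mul_self (T Z : Matrix ι ι ℝ) :
    ((T + Z) * (T + Z)).trace = (T * T).trace + 2 * (T * Z).trace + (Z * Z).trace := by
  simp only [add_mul, mul_add, Matrix.trace_add, Matrix.trace_mul_comm Z T]
  ring

/-- Expand the trace up to cyclic rotation. `‖TZ - ZT‖_F² ≥ 0` turns the term `TZTZ` into `T²Z²`,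
and `‖TZ - Z²‖_F² ≥ 0` splits `TZ³` between `T²Z²` and `Z⁴`. The term linear in `Z` stays exact,
since it vanishes in expectation. -/
theorem Matrix.trace_add_pow_four_le {T Z : Matrix ι ι ℝ} (hT : T.IsSymm) (hZ : Z.IsSymm) :
    ((T + Z) * (T + Z) * ((T + Z) * (T + Z))).trace ≤ (T * T * (T * T)).trace +
      4 * (T * T * T * Z).trace + 8 * (T * T * (Z * Z)).trace + 3 * (Z * Z * (Z * Z)).trace := by
  have h1 := Matrix.trace_transpose_mul_self_nonneg (T * Z - Z * T)
  have h2 := Matrix.trace_transpose_mul_self_nonneg (T * Z - Z * Z)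
  have hT' : T.transpose = T := hT
  have hZ' : Z.transpose = Z := hZ
  simp only [Matrix.transpose_sub, Matrix.transpose_mul, hT', hZ', sub_mul, mul_sub,
    Matrix.trace_sub] at h1 h2
  simp only [add_mul, mul_add, Matrix.trace_add]
  simp only [← mul_assoc] at h1 h2 ⊢
  have c := fun A B C D : Matrix ι ι ℝ => Matrix.trace_mul_comm (A * B * C) D
  simp only [← mul_assoc] at c
  have e1 := c T T Z T
  have e2 := c T Z T T
  have e3 := c Z T T T
  have e4 := c T T Z Z
  have e5 := c T Z Z T
  have e6 := c Z Z T T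
  have e7 := c Z T T Z
  have e8 := c T Z T Z
  have e9 := c Z T Z T
  have e10 := c Z Z Z T
  have e11 := c Z Z T Z
  have e12 := c Z T Z Z
  have e13 := c T Z Z Z
  linarith

theorem Matrix.measurable_mul {α : Type*} [MeasurableSpace α] {f g : α → Matrix ι ι ℝ}
    (hf : Measurable f) (hg : Measurable g) : Measurable fun x => f x * g x := by
  refine Matrix.measurable_of_apply fun a b => ?_
  simp only [Matrix.mul_apply]
  exact Finset.measurable_sum _ fun c _ => ((Matrix.measurable_apply a c).comp hf).mul
    ((Matrix.measurable_apply c b).comp hg)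

theorem BoundedEntries.mul {A B : Ω → Matrix ι ι ℝ} (hA : BoundedEntries P A)
    (hB : BoundedEntries P B) : BoundedEntries P fun ω => A ω * B ω := by
  intro a b
  simp only [Matrix.mul_apply]
  exact memLp_finsetSum _ fun c _ => (hB c b).mul (hA a c)

variable [IsProbabilityMeasure P]

theorem BoundedEntries.integrable_trace {A : Ω → Matrix ι ι ℝ} (hA : BoundedEntries P A) :
    Integrable (fun ω => (A ω).trace) P := by
  simp only [Matrix.trace, Matrix.diag]
  exact integrable_finsetSum _ fun a _ => (hA a a).integrable le_top

theorem BoundedEntries.integral_trace_mul_const {A : Ω → Matrix ι ι ℝ} (hA : BoundedEntries P A)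
    (C : Matrix ι ι ℝ) : ∫ ω, (A ω * C).trace ∂P = (expMatrix P A * C).trace := by
  simp only [Matrix.trace, Matrix.diag, Matrix.mul_apply, expMatrix, Matrix.of_apply]
  rw [integral_finsetSum _ fun a _ => integrable_finsetSum _ fun b _ =>
    ((hA a b).integrable le_top).mul_const _]
  refine Finset.sum_congr rfl fun a _ => ?_
  rw [integral_finsetSum _ fun b _ => ((hA a b).integrable le_top).mul_const _]
  simp only [integral_mul_const]

theorem integral_trace_mul_of_indepFun {A B : Ω → Matrix ι ι ℝ} (hA : BoundedEntries P A)
    (hB : BoundedEntries P B) (hAB : IndepFun A B P) :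
    ∫ ω, (A ω * B ω).trace ∂P = (expMatrix P A * expMatrix P B).trace := by
  have hi : ∀ a b, Integrable (fun ω => A ω a b * B ω b a) P := fun a b =>
    ((hB b a).mul (hA a b) (r := ⊤)).integrable le_top
  simp only [Matrix.trace, Matrix.diag, Matrix.mul_apply, expMatrix, Matrix.of_apply]
  rw [integral_finsetSum _ fun a _ => integrable_finsetSum _ fun b _ => hi a b]
  refine Finset.sum_congr rfl fun a _ => ?_
  rw [integral_finsetSum _ fun b _ => hi a b]
  refine Finset.sum_congr rfl fun b _ => ?_
  exact (hAB.comp (Matrix.measurable_apply a b)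
    (Matrix.measurable_apply b a)).integral_fun_mul_eq_mul_integral (hA a b).1 (hB b a).1

/-- The trace is the sum of the quadratic form `W` over the rows of `T`. -/
theorem Matrix.trace_sq_mul_le {T W : Matrix ι ι ℝ} {c : ℝ} (hT : T.IsSymm)
    (hW : ∀ v : ι → ℝ, ∑ a, ∑ b, v a * W a b * v b ≤ c * ∑ a, v a ^ 2) :
    (T * T * W).trace ≤ c * (T * T).trace := by
  have h3 : (T * T * W).trace = ∑ k, ∑ a, ∑ b, T k a * W a b * T k b := by
    rw [mul_assoc, Matrix.trace_mul_comm]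
    simp only [Matrix.trace, Matrix.diag, Matrix.mul_apply, Finset.sum_mul]
    refine Finset.sum_congr rfl fun k _ => ?_
    rw [Finset.sum_comm]
    exact Finset.sum_congr rfl fun a _ => Finset.sum_congr rfl fun b _ => by rw [hT.apply k b]
  have h4 : (T * T).trace = ∑ k, ∑ a, T k a ^ 2 := by
    simp only [Matrix.trace, Matrix.diag, Matrix.mul_apply]
    refine Finset.sum_congr rfl fun k _ => Finset.sum_congr rfl fun a _ => ?_
    rw [hT.apply k a, sq]
  rw [h3, h4, Finset.mul_sum]
  exact Finset.sum_le_sum fun k _ => hW _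

theorem integral_trace_sq_mul_le {T : Ω → Matrix ι ι ℝ} {W : Matrix ι ι ℝ} {c : ℝ}
    (hTb : BoundedEntries P T) (hT : ∀ ω, (T ω).IsSymm)
    (hW : ∀ v : ι → ℝ, ∑ a, ∑ b, v a * W a b * v b ≤ c * ∑ a, v a ^ 2) :
    ∫ ω, (T ω * T ω * W).trace ∂P ≤ c * ∫ ω, (T ω * T ω).trace ∂P := by
  have hWb : BoundedEntries P fun _ : Ω => W := fun a b => memLp_const _
  have h1 := ((hTb.mul hTb).mul hWb).integrable_trace
  have h2 := (hTb.mul hTb).integrable_trace.const_mul c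
  rw [← integral_const_mul]
  exact integral_mono h1 h2 fun ω => Matrix.trace_sq_mul_le (hT ω) hW

/-- Fourth moment bound for a sum of independent centred random symmetric matrices. -/
theorem integral_trace_sum_pow_four_le {Z : κ → Ω → Matrix ι ι ℝ} {c : ℝ} (hc : 0 ≤ c)
    (hsym : ∀ i ω, (Z i ω).IsSymm) (hmeas : ∀ i, Measurable (Z i))
    (hbdd : ∀ i, BoundedEntries P (Z i)) (hind : iIndepFun Z P)
    (hmean : ∀ i, expMatrix P (Z i) = 0)
    (hvar : ∀ i (v : ι → ℝ), ∑ a, ∑ b, v a * expMatrix P (fun ω => Z i ω * Z i ω) a b * v b ≤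
      c * ∑ a, v a ^ 2)
    (htr2 : ∀ i, ∫ ω, (Z i ω * Z i ω).trace ∂P ≤ 1)
    (htr4 : ∀ i, ∫ ω, (Z i ω * Z i ω * (Z i ω * Z i ω)).trace ∂P ≤ 16) (s : Finset κ) :
    ∫ ω, ((∑ i ∈ s, Z i ω) * (∑ i ∈ s, Z i ω)).trace ∂P ≤ s.card ∧
    ∫ ω, ((∑ i ∈ s, Z i ω) * (∑ i ∈ s, Z i ω) *
      ((∑ i ∈ s, Z i ω) * (∑ i ∈ s, Z i ω))).trace ∂P ≤ 8 * c * s.card ^ 2 + 48 * s.card := by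
  classical
  -- Adding `Z i` to the independent sum `T` kills the terms linear in `Z i`. The remaining
  -- increment is at most `8 c |s| + 48`, using `𝔼 tr T² ≤ |s|`; summing gives the quadratic growth
  -- in `|s|`.
  induction s using Finset.induction_on with
  | empty => simp
  | insert i s hi ih =>
    obtain ⟨ih2, ih4⟩ := ih
    set T : Ω → Matrix ι ι ℝ := fun ω => ∑ j ∈ s, Z j ω with hT
    have hTs : ∀ ω, (T ω).IsSymm := fun ω => by
      change (∑ j ∈ s, Z j ω).transpose = ∑ j ∈ s, Z j ω
      rw [Matrix.transpose_sum]
      exact Finset.sum_congr rfl fun j _ => hsym j ω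
    have hTb : BoundedEntries P T := BoundedEntries.sum hbdd s
    have hTm : Measurable T := by
      have := Finset.measurable_sum s fun j (_ : j ∈ s) => hmeas j
      simpa only [hT] using this
    have hTZ : IndepFun T (Z i) P := by
      have := hind.indepFun_finsetSum_of_notMem hmeas hi
      have h2 : (∑ j ∈ s, Z j) = T := by funext ω; simp [hT]
      rwa [h2] at this
    have hZb := hbdd i
    have hsum : ∀ ω, ∑ j ∈ insert i s, Z j ω = T ω + Z i ω := fun ω => by
      rw [Finset.sum_insert hi, add_comm]
    have hcard : ((insert i s).card : ℝ) = s.card + 1 := by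
      rw [Finset.card_insert_of_notMem hi]; push_cast; ring
    have hTZ0 : ∫ ω, (T ω * Z i ω).trace ∂P = 0 := by
      rw [integral_trace_mul_of_indepFun hTb hZb hTZ, hmean, mul_zero, Matrix.trace_zero]
    have hT3Z0 : ∫ ω, (T ω * T ω * T ω * Z i ω).trace ∂P = 0 := by
      have h1 : IndepFun (fun ω => T ω * T ω * T ω) (Z i) P :=
        hTZ.comp (φ := fun A => A * A * A) (ψ := id)
          (Matrix.measurable_mul (Matrix.measurable_mul measurable_id measurable_id) measurable_id)
          measurable_id
      rw [integral_trace_mul_of_indepFun ((hTb.mul hTb).mul hTb) hZb h1, hmean, mul_zero,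
        Matrix.trace_zero]
    have hT2Z2 : ∫ ω, (T ω * T ω * (Z i ω * Z i ω)).trace ∂P ≤ c * s.card := by
      have h1 : IndepFun (fun ω => T ω * T ω) (fun ω => Z i ω * Z i ω) P :=
        hTZ.comp (φ := fun A => A * A) (ψ := fun A => A * A)
          (Matrix.measurable_mul measurable_id measurable_id)
          (Matrix.measurable_mul measurable_id measurable_id)
      rw [integral_trace_mul_of_indepFun (hTb.mul hTb) (hZb.mul hZb) h1,
        ← (hTb.mul hTb).integral_trace_mul_const]
      exact (integral_trace_sq_mul_le hTb hTs (hvar i)).trans (mul_le_mul_of_nonneg_left ih2 hc)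
    simp only [hsum, hcard]
    have i1 := (hTb.mul hTb).integrable_trace
    have i2 := (hTb.mul hZb).integrable_trace.const_mul 2
    have i3 := (hZb.mul hZb).integrable_trace
    have j1 := ((hTb.mul hTb).mul (hTb.mul hTb)).integrable_trace
    have j2 := (((hTb.mul hTb).mul hTb).mul hZb).integrable_trace.const_mul 4
    have j3 := ((hTb.mul hTb).mul (hZb.mul hZb)).integrable_trace.const_mul 8
    have j4 := ((hZb.mul hZb).mul (hZb.mul hZb)).integrable_trace.const_mul 3
    constructor
    · simp only [Matrix.trace_add_mul_self]
      rw [integral_add (i1.fun_add i2) i3, integral_add i1 i2, integral_const_mul, hTZ0]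
      linarith [htr2 i]
    · have hS := (hTb.add hZb)
      calc _ ≤ ∫ ω, ((T ω * T ω * (T ω * T ω)).trace + 4 * (T ω * T ω * T ω * Z i ω).trace +
            8 * (T ω * T ω * (Z i ω * Z i ω)).trace +
            3 * (Z i ω * Z i ω * (Z i ω * Z i ω)).trace) ∂P :=
            integral_mono ((hS.mul hS).mul (hS.mul hS)).integrable_trace
              (((j1.add j2).add j3).add j4)
              fun ω => Matrix.trace_add_pow_four_le (hTs ω) (hsym i ω)
        _ ≤ (8 * c * s.card ^ 2 + 48 * s.card) + 4 * 0 + 8 * (c * s.card) + 3 * 16 := by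
            rw [integral_add ((j1.fun_add j2).fun_add j3) j4, integral_add (j1.fun_add j2) j3,
              integral_add j1 j2, integral_const_mul, integral_const_mul, integral_const_mul,
              hT3Z0]
            linarith [htr4 i]
        _ ≤ _ := by
            have : 0 ≤ c * s.card := by positivity
            nlinarith

end RandomMatrices

/-! ### Centred outer products of a bounded random vector. -/

section OuterProducts

variable {ι α : Type*} [MeasurableSpace α] {σ : Measure α}

/-- The centred outer product `y yᵀ - 𝔼 y yᵀ` of a random vector. -/
noncomputable def centredOuter (σ : Measure α) (y : α → ι → ℝ) (x : α) : Matrix ι ι ℝ :=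
  Matrix.of fun a b => y x a * y x b - ∫ z, y z a * y z b ∂σ

theorem centredOuter_isSymm (y : α → ι → ℝ) (x : α) : (centredOuter σ y x).IsSymm := by
  ext a b
  simp [centredOuter, mul_comm]

theorem measurable_centredOuter {y : α → ι → ℝ} (hy : ∀ a, Measurable fun x => y x a) :
    Measurable (centredOuter σ y) :=
  Matrix.measurable_of_apply fun a b => ((hy a).mul (hy b)).sub_const _

variable [Fintype ι]

theorem Matrix.trace_pow_four_le {A : Matrix ι ι ℝ} (hA : A.IsSymm) :
    (A * A * (A * A)).trace ≤ (A * A).trace ^ 2 := by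
  have h1 : (A * A).trace = ∑ a, ∑ k, A a k ^ 2 := by
    simp only [Matrix.trace, Matrix.diag, Matrix.mul_apply]
    refine Finset.sum_congr rfl fun k _ => Finset.sum_congr rfl fun a _ => ?_
    rw [hA.apply k a, sq]
  have h2 : (A * A * (A * A)).trace = ∑ a, ∑ b, (∑ k, A a k * A b k) ^ 2 := by
    have : ∀ a b, (A * A) a b = ∑ k, A a k * A b k := fun a b => by
      rw [Matrix.mul_apply]
      exact Finset.sum_congr rfl fun k _ => by rw [hA.apply b k]
    rw [Matrix.trace]
    simp only [Matrix.diag]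
    refine Finset.sum_congr rfl fun a _ => ?_
    rw [Matrix.mul_apply]
    refine Finset.sum_congr rfl fun b _ => ?_
    rw [this, this, sq]
    simp only [mul_comm]
  rw [h1, h2, sq, Finset.sum_mul_sum]
  exact Finset.sum_le_sum fun a _ => Finset.sum_le_sum fun b _ =>
    Finset.sum_mul_sq_le_sq_mul_sq _ _ _

theorem memLp_coordinate {y : α → ι → ℝ} (hy : ∀ a, Measurable fun x => y x a)
    (hy1 : ∀ᵐ x ∂σ, ∑ a, y x a ^ 2 ≤ 1) (a : ι) : MemLp (fun x => y x a) ⊤ σ := by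
  refine memLp_top_of_bound (hy a).aestronglyMeasurable 1 ?_
  filter_upwards [hy1] with x hx
  have := (Finset.single_le_sum (fun i _ => sq_nonneg (y x i)) (Finset.mem_univ a)).trans hx
  rw [Real.norm_eq_abs]
  exact abs_le_one_iff_mul_self_le_one.2 (by nlinarith)

theorem memLp_outer {y : α → ι → ℝ} (hy : ∀ a, Measurable fun x => y x a)
    (hy1 : ∀ᵐ x ∂σ, ∑ a, y x a ^ 2 ≤ 1) (a b : ι) : MemLp (fun x => y x a * y x b) ⊤ σ :=
  (memLp_coordinate hy hy1 b).mul (memLp_coordinate hy hy1 a)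

theorem trace_centredOuter_sq (y : α → ι → ℝ) (x : α) :
    (centredOuter σ y x * centredOuter σ y x).trace =
      ∑ a, ∑ b, (y x a * y x b - ∫ z, y z a * y z b ∂σ) ^ 2 := by
  simp only [Matrix.trace, Matrix.diag, Matrix.mul_apply]
  refine Finset.sum_congr rfl fun a _ => Finset.sum_congr rfl fun b _ => ?_
  rw [(centredOuter_isSymm (σ := σ) y x).apply a b, ← sq]
  rfl

theorem sum_outer_sq (v : ι → ℝ) : ∑ a, ∑ b, (v a * v b) ^ 2 = (∑ a, v a ^ 2) ^ 2 := by
  rw [sq (∑ a, v a ^ 2), Finset.sum_mul_sum]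
  simp only [mul_pow]

variable [IsProbabilityMeasure σ]

theorem integral_sub_integral_sq {f : α → ℝ} (hf : MemLp f ⊤ σ) :
    ∫ x, (f x - ∫ z, f z ∂σ) ^ 2 ∂σ = ∫ x, f x ^ 2 ∂σ - (∫ x, f x ∂σ) ^ 2 := by
  set m := ∫ z, f z ∂σ with hm
  have h1 : Integrable (fun x => f x ^ 2) σ := by
    simp only [sq]
    exact (hf.mul hf (r := ⊤)).integrable le_top
  have h2 : Integrable (fun x => 2 * m * f x) σ := (hf.integrable le_top).const_mul _
  have h12 : Integrable (fun x => f x ^ 2 - 2 * m * f x) σ := h1.sub h2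
  have : ∀ x, (f x - m) ^ 2 = f x ^ 2 - 2 * m * f x + m ^ 2 := fun x => by ring
  simp only [this]
  rw [integral_add h12 (integrable_const _), integral_sub h1 h2, integral_const_mul, ← hm]
  simp
  ring

theorem boundedEntries_centredOuter {y : α → ι → ℝ} (hy : ∀ a, Measurable fun x => y x a)
    (hy1 : ∀ᵐ x ∂σ, ∑ a, y x a ^ 2 ≤ 1) : BoundedEntries σ (centredOuter σ y) :=
  fun a b => (memLp_outer hy hy1 a b).sub (memLp_const _)

theorem expMatrix_centredOuter {y : α → ι → ℝ} (hy : ∀ a, Measurable fun x => y x a)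
    (hy1 : ∀ᵐ x ∂σ, ∑ a, y x a ^ 2 ≤ 1) : expMatrix σ (centredOuter σ y) = 0 := by
  ext a b
  simp only [expMatrix, centredOuter, Matrix.of_apply, Matrix.zero_apply]
  rw [integral_sub ((memLp_outer hy hy1 a b).integrable le_top) (integrable_const _)]
  simp

theorem integrable_outer_sq {y : α → ι → ℝ} (hy : ∀ a, Measurable fun x => y x a)
    (hy1 : ∀ᵐ x ∂σ, ∑ a, y x a ^ 2 ≤ 1) (a b : ι) :
    Integrable (fun x => (y x a * y x b) ^ 2) σ := by
  simp only [sq]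
  exact ((memLp_outer hy hy1 a b).mul (memLp_outer hy hy1 a b) (r := ⊤)).integrable le_top

theorem sum_integral_outer_sq_le {y : α → ι → ℝ} (hy : ∀ a, Measurable fun x => y x a)
    (hy1 : ∀ᵐ x ∂σ, ∑ a, y x a ^ 2 ≤ 1) :
    ∑ a, ∑ b, ∫ x, (y x a * y x b) ^ 2 ∂σ ≤ 1 := by
  have h1 : ∑ a, ∑ b, ∫ x, (y x a * y x b) ^ 2 ∂σ = ∫ x, (∑ a, y x a ^ 2) ^ 2 ∂σ := by
    simp only [← sum_outer_sq]
    rw [integral_finsetSum _ fun a _ => integrable_finsetSum _ fun b _ =>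
      integrable_outer_sq hy hy1 a b]
    refine Finset.sum_congr rfl fun a _ => ?_
    rw [integral_finsetSum _ fun b _ => integrable_outer_sq hy hy1 a b]
  have h2 : Integrable (fun x => (∑ a, y x a ^ 2) ^ 2) σ := by
    simp only [← sum_outer_sq]
    exact integrable_finsetSum _ fun a _ => integrable_finsetSum _ fun b _ =>
      integrable_outer_sq hy hy1 a b
  rw [h1]
  calc _ ≤ ∫ _, (1 : ℝ) ∂σ := by
        refine integral_mono_ae h2 (integrable_const _) ?_
        filter_upwards [hy1] with x hx
        exact pow_le_one₀ (Finset.sum_nonneg fun _ _ => sq_nonneg _) hx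
    _ = 1 := by simp

theorem integral_trace_centredOuter_sq_le {y : α → ι → ℝ} (hy : ∀ a, Measurable fun x => y x a)
    (hy1 : ∀ᵐ x ∂σ, ∑ a, y x a ^ 2 ≤ 1) :
    ∫ x, (centredOuter σ y x * centredOuter σ y x).trace ∂σ ≤ 1 := by
  have hi : ∀ a b, Integrable (fun x => (y x a * y x b - ∫ z, y z a * y z b ∂σ) ^ 2) σ :=
    fun a b => by
      have := (memLp_outer hy hy1 a b).sub (memLp_const (∫ z, y z a * y z b ∂σ))
      simp only [sq]
      exact (this.mul this (r := ⊤)).integrable le_top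
  simp only [trace_centredOuter_sq]
  rw [integral_finsetSum _ fun a _ => integrable_finsetSum _ fun b _ => hi a b]
  refine le_trans (Finset.sum_le_sum fun a _ => ?_) (sum_integral_outer_sq_le hy hy1)
  rw [integral_finsetSum _ fun b _ => hi a b]
  refine Finset.sum_le_sum fun b _ => ?_
  rw [integral_sub_integral_sq (memLp_outer hy hy1 a b)]
  linarith [sq_nonneg (∫ z, y z a * y z b ∂σ)]

theorem integral_trace_centredOuter_pow_four_le {y : α → ι → ℝ}
    (hy : ∀ a, Measurable fun x => y x a) (hy1 : ∀ᵐ x ∂σ, ∑ a, y x a ^ 2 ≤ 1) :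
    ∫ x, (centredOuter σ y x * centredOuter σ y x *
      (centredOuter σ y x * centredOuter σ y x)).trace ∂σ ≤ 16 := by
  have hM : ∑ a, ∑ b, (∫ z, y z a * y z b ∂σ) ^ 2 ≤ 1 := by
    refine le_trans ?_ (sum_integral_outer_sq_le hy hy1)
    refine Finset.sum_le_sum fun a _ => Finset.sum_le_sum fun b _ => ?_
    have h1 := integral_sub_integral_sq (memLp_outer hy hy1 a b)
    have h2 : 0 ≤ ∫ x, (y x a * y x b - ∫ z, y z a * y z b ∂σ) ^ 2 ∂σ :=
      integral_nonneg fun _ => sq_nonneg _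
    linarith
  have hb := boundedEntries_centredOuter hy hy1
  calc _ ≤ ∫ _, (16 : ℝ) ∂σ := by
        refine integral_mono_ae ((hb.mul hb).mul (hb.mul hb)).integrable_trace
          (integrable_const _) ?_
        filter_upwards [hy1] with x hx
        -- Both `y yᵀ` and its mean have Frobenius norm at most one, so the difference has squared
        -- norm at most `4`; squaring gives `16`.
        have h4 : (centredOuter σ y x * centredOuter σ y x).trace ≤ 4 := by
          rw [trace_centredOuter_sq]
          calc _ ≤ ∑ a, ∑ b, (2 * (y x a * y x b) ^ 2 + 2 * (∫ z, y z a * y z b ∂σ) ^ 2) :=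
                Finset.sum_le_sum fun a _ => Finset.sum_le_sum fun b _ => by
                  nlinarith [sq_nonneg (y x a * y x b + ∫ z, y z a * y z b ∂σ)]
            _ = 2 * (∑ a, y x a ^ 2) ^ 2 + 2 * ∑ a, ∑ b, (∫ z, y z a * y z b ∂σ) ^ 2 := by
                simp only [Finset.sum_add_distrib, ← Finset.mul_sum, sum_outer_sq]
            _ ≤ 4 := by
                have := pow_le_one₀ (n := 2) (Finset.sum_nonneg fun a _ => sq_nonneg (y x a)) hx
                linarith
        refine (Matrix.trace_pow_four_le (centredOuter_isSymm y x)).trans ?_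
        have h0 := Matrix.trace_mul_self_nonneg (centredOuter_isSymm (σ := σ) y x)
        nlinarith
    _ = 16 := by simp

/-- With `Z` the centred outer product, `vᵀ 𝔼[Z²] v = 𝔼 ‖Z v‖²` is the sum of the variances of `y k
* ⟪v, y⟫`, hence at most `𝔼 ‖y‖² ⟪v, y⟫² ≤ 𝔼 ⟪v, y⟫²`. -/
theorem quadForm_centredOuter_sq_le {y : α → ι → ℝ}
    (hy : ∀ a, Measurable fun x => y x a) (hy1 : ∀ᵐ x ∂σ, ∑ a, y x a ^ 2 ≤ 1) {c : ℝ}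
    (hc : ∀ v : ι → ℝ, ∫ x, (∑ a, v a * y x a) ^ 2 ∂σ ≤ c * ∑ a, v a ^ 2) (v : ι → ℝ) :
    ∑ a, ∑ b, v a * expMatrix σ (fun x => centredOuter σ y x * centredOuter σ y x) a b * v b ≤
      c * ∑ a, v a ^ 2 := by
  set f : ι → α → ℝ := fun k x => y x k * ∑ a, v a * y x a with hf
  have hl : MemLp (fun x => ∑ a, v a * y x a) ⊤ σ :=
    memLp_finsetSum _ fun a _ => (memLp_coordinate hy hy1 a).const_mul _
  have hfm : ∀ k, MemLp (f k) ⊤ σ := fun k => hl.mul (memLp_coordinate hy hy1 k)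
  have hfi : ∀ k, Integrable (fun x => f k x ^ 2) σ := fun k => by
    simp only [sq]
    exact ((hfm k).mul (hfm k) (r := ⊤)).integrable le_top
  have hgi : ∀ k, Integrable (fun x => (f k x - ∫ z, f k z ∂σ) ^ 2) σ := fun k => by
    have := (hfm k).sub (memLp_const (∫ z, f k z ∂σ))
    simp only [sq]
    exact (this.mul this (r := ⊤)).integrable le_top
  have hli : Integrable (fun x => (∑ a, v a * y x a) ^ 2) σ := by
    simp only [sq]
    exact (hl.mul hl (r := ⊤)).integrable le_top
  have hb := boundedEntries_centredOuter hy hy1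
  have hfk : ∀ k x, ∑ a, v a * centredOuter σ y x a k = f k x - ∫ z, f k z ∂σ := by
    intro k x
    have : ∫ z, f k z ∂σ = ∑ a, v a * ∫ z, y z a * y z k ∂σ := by
      simp only [hf, Finset.mul_sum]
      rw [integral_finsetSum]
      · refine Finset.sum_congr rfl fun a _ => ?_
        rw [← integral_const_mul]
        congr 1
        funext z
        ring
      · intro a _
        have := ((memLp_outer hy hy1 a k).integrable le_top).const_mul (v a)
        refine this.congr (Filter.Eventually.of_forall fun z => ?_)
        simp only
        ring
    rw [this]
    simp only [hf, centredOuter, Matrix.of_apply, mul_sub, Finset.sum_sub_distrib, Finset.mul_sum]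
    congr 1
    exact Finset.sum_congr rfl fun a _ => by ring
  have hquad : ∀ x, ∑ a, ∑ b, v a * (centredOuter σ y x * centredOuter σ y x) a b * v b =
      ∑ k, (f k x - ∫ z, f k z ∂σ) ^ 2 := by
    intro x
    simp only [← hfk, sq, Matrix.mul_apply, Finset.mul_sum, Finset.sum_mul]
    calc _ = ∑ a, ∑ k, ∑ b, v a * (centredOuter σ y x a k * centredOuter σ y x k b) * v b :=
          Finset.sum_congr rfl fun a _ => Finset.sum_comm
      _ = _ := by
          rw [Finset.sum_comm]
          refine Finset.sum_congr rfl fun k _ => Finset.sum_congr rfl fun a _ =>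
            Finset.sum_congr rfl fun b _ => ?_
          rw [(centredOuter_isSymm (σ := σ) y x).apply b k]
          ring
  calc _ = ∫ x, ∑ a, ∑ b, v a * (centredOuter σ y x * centredOuter σ y x) a b * v b ∂σ := by
        have hi : ∀ a b, Integrable
            (fun x => v a * (centredOuter σ y x * centredOuter σ y x) a b * v b) σ :=
          fun a b => ((((hb.mul hb) a b).integrable le_top).const_mul _).mul_const _
        rw [integral_finsetSum _ fun a _ => integrable_finsetSum _ fun b _ => hi a b]
        refine Finset.sum_congr rfl fun a _ => ?_
        rw [integral_finsetSum _ fun b _ => hi a b]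
        refine Finset.sum_congr rfl fun b _ => ?_
        rw [integral_mul_const, integral_const_mul]
        rfl
    _ = ∑ k, ∫ x, (f k x - ∫ z, f k z ∂σ) ^ 2 ∂σ := by
        simp only [hquad]
        exact integral_finsetSum _ fun k _ => hgi k
    _ ≤ ∑ k, ∫ x, f k x ^ 2 ∂σ := Finset.sum_le_sum fun k _ => by
        rw [integral_sub_integral_sq (hfm k)]
        linarith [sq_nonneg (∫ x, f k x ∂σ)]
    _ = ∫ x, ∑ k, f k x ^ 2 ∂σ := (integral_finsetSum _ fun k _ => hfi k).symm
    _ ≤ ∫ x, (∑ a, v a * y x a) ^ 2 ∂σ := by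
        refine integral_mono_ae (integrable_finsetSum _ fun k _ => hfi k) hli ?_
        filter_upwards [hy1] with x hx
        simp only [hf, mul_pow, ← Finset.sum_mul]
        exact mul_le_of_le_one_left (sq_nonneg _) hx
    _ ≤ _ := hc v

/-- Fourth moment bound for the deviation of the empirical second moment matrix of an independent
sample of a bounded random vector. -/
theorem integral_trace_sum_centredOuter_pow_four_le {κ : Type*} [Fintype κ] {y : α → ι → ℝ}
    (hy : ∀ a, Measurable fun x => y x a) (hy1 : ∀ᵐ x ∂σ, ∑ a, y x a ^ 2 ≤ 1) {c : ℝ}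
    (hc0 : 0 ≤ c)
    (hc : ∀ v : ι → ℝ, ∫ x, (∑ a, v a * y x a) ^ 2 ∂σ ≤ c * ∑ a, v a ^ 2) :
    ∫ ω, ((∑ i, centredOuter σ y (ω i)) * (∑ i, centredOuter σ y (ω i)) *
      ((∑ i, centredOuter σ y (ω i)) * (∑ i, centredOuter σ y (ω i)))).trace
        ∂Measure.pi (fun _ : κ => σ) ≤ 8 * c * Fintype.card κ ^ 2 + 48 * Fintype.card κ := by
  have hm := measurable_centredOuter (σ := σ) hy
  have hb := boundedEntries_centredOuter hy hy1
  have hmp : ∀ i : κ, MeasurePreserving (fun ω : κ → α => ω i) (Measure.pi fun _ : κ => σ) σ :=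
    fun i => measurePreserving_eval (fun _ : κ => σ) i
  have hint : ∀ (i : κ) {f : α → ℝ}, AEStronglyMeasurable f σ →
      ∫ ω, f (ω i) ∂Measure.pi (fun _ : κ => σ) = ∫ x, f x ∂σ := fun i f hf => by
    have := integral_map (hmp i).measurable.aemeasurable (by rwa [(hmp i).map_eq]) (f := f)
    rw [← this, (hmp i).map_eq]
  have hexp : ∀ (i : κ) {A : α → Matrix ι ι ℝ}, BoundedEntries σ A →
      expMatrix (Measure.pi fun _ : κ => σ) (fun ω => A (ω i)) = expMatrix σ A := fun i A hA => by
    ext a b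
    exact hint i (hA a b).1
  refine (integral_trace_sum_pow_four_le (P := Measure.pi fun _ : κ => σ)
    (Z := fun i ω => centredOuter σ y (ω i)) hc0 (fun i ω => centredOuter_isSymm y _)
    (fun i => hm.comp (measurable_pi_apply i))
    (fun i a b => (hb a b).comp_measurePreserving (hmp i)) ?_ ?_ ?_ ?_ ?_ Finset.univ).2
  · exact iIndepFun_pi (X := fun _ => centredOuter σ y) fun i => hm.aemeasurable
  · intro i
    rw [hexp i hb, expMatrix_centredOuter hy hy1]
  · intro i v
    rw [hexp i (hb.mul hb)]
    exact quadForm_centredOuter_sq_le hy hy1 hc v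
  · intro i
    rw [hint i (hb.mul hb).integrable_trace.1]
    exact integral_trace_centredOuter_sq_le hy hy1
  · intro i
    rw [hint i ((hb.mul hb).mul (hb.mul hb)).integrable_trace.1]
    exact integral_trace_centredOuter_pow_four_le hy hy1

end OuterProducts

/-! ### From the trace of the fourth power to `QuadBound`. -/

section QuadraticFormEvent

open scoped RealInnerProductSpace

/-- Cauchy–Schwarz twice: `(vᵀTv)² ≤ ‖v‖² vᵀT²v`, then the same for `T²`, with `‖T² v‖²` bounded
through the Frobenius norm of `T²`. -/
theorem Matrix.quadForm_pow_four_le {ι : Type*} [Fintype ι] {T : Matrix ι ι ℝ} (hT : T.IsSymm)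
    (v : ι → ℝ) :
    (∑ a, ∑ b, v a * T a b * v b) ^ 4 ≤ (T * T * (T * T)).trace * (∑ a, v a ^ 2) ^ 4 := by
  set N := ∑ a, v a ^ 2 with hN
  have hN0 : 0 ≤ N := Finset.sum_nonneg fun _ _ => sq_nonneg _
  have hq : ∀ A : Matrix ι ι ℝ, (∑ a, ∑ b, v a * A a b * v b) ^ 2 ≤
      N * ∑ a, (∑ b, A a b * v b) ^ 2 := fun A => by
    have : ∑ a, ∑ b, v a * A a b * v b = ∑ a, v a * ∑ b, A a b * v b := by
      simp only [Finset.mul_sum, mul_assoc]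
    rw [this]
    exact Finset.sum_mul_sq_le_sq_mul_sq _ _ _
  have h1 := hq T
  have h2 := hq (T * T)
  have h3 : ∑ a, (∑ b, T a b * v b) ^ 2 = ∑ a, ∑ b, v a * (T * T) a b * v b := by
    simp only [sq, Matrix.mul_apply, Finset.mul_sum, Finset.sum_mul]
    rw [Finset.sum_comm]
    refine Finset.sum_congr rfl fun a _ => ?_
    rw [Finset.sum_comm]
    refine Finset.sum_congr rfl fun b _ => Finset.sum_congr rfl fun k _ => ?_
    rw [hT.apply a k]
    ring
  have h4 : ∑ a, (∑ b, (T * T) a b * v b) ^ 2 ≤ (T * T * (T * T)).trace * N := by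
    have hTT : (T * T).IsSymm := by
      change (T * T).transpose = T * T
      rw [Matrix.transpose_mul, hT]
    rw [Matrix.trace, Finset.sum_mul]
    refine Finset.sum_le_sum fun a _ => ?_
    have h5 := Finset.sum_mul_sq_le_sq_mul_sq Finset.univ (fun b => (T * T) a b) v
    have h6 : ∑ b, (T * T) a b ^ 2 = (T * T * (T * T)).diag a := by
      rw [Matrix.diag, Matrix.mul_apply]
      exact Finset.sum_congr rfl fun b _ => by rw [hTT.apply a b, sq]
    rwa [h6] at h5
  rw [h3] at h1
  set p := ∑ a, ∑ b, v a * T a b * v b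
  set q := ∑ a, ∑ b, v a * (T * T) a b * v b
  calc p ^ 4 = (p ^ 2) ^ 2 := by ring
    _ ≤ (N * q) ^ 2 := pow_le_pow_left₀ (sq_nonneg _) h1 2
    _ = N ^ 2 * q ^ 2 := by ring
    _ ≤ N ^ 2 * (N * ((T * T * (T * T)).trace * N)) := by gcongr; exact h2.trans (by gcongr)
    _ = _ := by ring

variable {d : ℕ} {κ : Type*} [Fintype κ]

/-- The deviation of the second moment matrix of the traceless squares of `x` from its mean. -/
noncomputable def squareDeviation (x : κ → EuclideanSpace ℝ (Fin d)) :
    Matrix (Fin d × Fin d) (Fin d × Fin d) ℝ :=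
  ∑ i, centredOuter (uniformSphere d 1) tracelessSquare (x i)

theorem squareDeviation_isSymm (x : κ → EuclideanSpace ℝ (Fin d)) :
    (squareDeviation x).IsSymm := by
  change (squareDeviation x).transpose = squareDeviation x
  rw [squareDeviation, Matrix.transpose_sum]
  exact Finset.sum_congr rfl fun j _ => centredOuter_isSymm _ _

theorem sum_mul_tracelessSquare
    {X : EuclideanSpace ℝ (Fin d) →ₗ[ℝ] EuclideanSpace ℝ (Fin d)}
    (htr : ∑ a, ⟪EuclideanSpace.basisFun (Fin d) ℝ a,
      X (EuclideanSpace.basisFun (Fin d) ℝ a)⟫ = 0) (x : EuclideanSpace ℝ (Fin d)) :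
    ∑ p : Fin d × Fin d, ⟪EuclideanSpace.basisFun (Fin d) ℝ p.1,
      X (EuclideanSpace.basisFun (Fin d) ℝ p.2)⟫ * tracelessSquare x p = ⟪x, X x⟫ := by
  set e := EuclideanSpace.basisFun (Fin d) ℝ with he
  have h1 : ⟪x, X x⟫ = ∑ a, ∑ b, ⟪e a, X (e b)⟫ * (x a * x b) := by
    have hx : ∑ a, x a • e a = x := by
      have := e.sum_repr x
      simpa [he] using this
    conv_lhs => rw [← hx]
    simp only [map_sum, map_smul, sum_inner, inner_sum, inner_smul_left, inner_smul_right,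
      conj_trivial]
    rw [Finset.sum_comm]
    refine Finset.sum_congr rfl fun a _ => ?_
    rw [Finset.mul_sum]
    exact Finset.sum_congr rfl fun b _ => by ring
  have h2 : ∀ a b, ⟪e a, X (e b)⟫ * tracelessSquare x (a, b) =
      ⟪e a, X (e b)⟫ * (x a * x b) - if a = b then 1 / d * ⟪e a, X (e a)⟫ else 0 := by
    intro a b
    simp only [tracelessSquare]
    split_ifs with h
    · subst h; ring
    · ring
  rw [Fintype.sum_prod_type, h1]
  simp only [h2, Finset.sum_sub_distrib, Finset.sum_ite_eq, Finset.mem_univ, if_true,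
    ← Finset.mul_sum, htr]
  simp

/-- For traceless `X`, the form of `squareDeviation x` at the matrix entries of `X` is `∑ ⟪x i, X (x
i)⟫²` minus its mean. After weighting, the mean contributes at most `1/2` when `d ≥ 2` and the
deviation `1/16`, adding up to `(3/4)²`. -/
theorem quadBound_of_squareDeviation (hd : 1 ≤ d) {w : ℝ}
    (hc : w * Fintype.card κ = d) {x : κ → EuclideanSpace ℝ (Fin d)}
    (hT : w ^ 4 * (squareDeviation x * squareDeviation x *
      (squareDeviation x * squareDeviation x)).trace ≤ (1 / 16) ^ 4) :
    QuadBound (EuclideanSpace.basisFun (Fin d) ℝ) w (3 / 4) x := by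
  intro X hX htr
  set e := EuclideanSpace.basisFun (Fin d) ℝ with he
  set v : Fin d × Fin d → ℝ := fun p => ⟪e p.1, X (e p.2)⟫ with hv
  have := isProbabilityMeasure_uniformSphere hd 1
  have hd0 : (1 : ℝ) ≤ d := by exact_mod_cast hd
  have hF0 := frobSq_nonneg e X
  have hvF : ∑ p, v p ^ 2 = frobSq e X := by
    rw [Fintype.sum_prod_type, Finset.sum_comm, frobSq]
    simp only [hv, sum_inner_sq_eq]
  have hvx : ∀ z, ∑ p, v p * tracelessSquare z p = ⟪z, X z⟫ := sum_mul_tracelessSquare htr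
  have hone : ∀ z, ∑ p, ∑ q, v p *
      centredOuter (uniformSphere d 1) tracelessSquare z p q * v q =
        ⟪z, X z⟫ ^ 2 - 2 / (d * (d + 2)) * frobSq e X := by
    intro z
    rw [← integral_inner_apply_sq hd e hX htr]
    have hsq : ∀ u, ⟪u, X u⟫ ^ 2 =
        ∑ p, ∑ q, v p * v q * (tracelessSquare u p * tracelessSquare u q) := fun u => by
      rw [← hvx, sq, Finset.sum_mul_sum]
      exact Finset.sum_congr rfl fun p _ => Finset.sum_congr rfl fun q _ => by ring
    have hi : ∀ p q, Integrable (fun u => v p * v q *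
        (tracelessSquare u p * tracelessSquare u q)) (uniformSphere d 1) := fun p q =>
      integrable_uniformSphere hd (continuous_const.mul
        ((continuous_tracelessSquare p).mul (continuous_tracelessSquare q)))
    simp only [hsq]
    rw [integral_finsetSum _ fun p _ => integrable_finsetSum _ fun q _ => hi p q,
      ← Finset.sum_sub_distrib]
    refine Finset.sum_congr rfl fun p _ => ?_
    rw [integral_finsetSum _ fun q _ => hi p q, ← Finset.sum_sub_distrib]
    refine Finset.sum_congr rfl fun q _ => ?_
    rw [integral_const_mul]
    simp only [centredOuter, Matrix.of_apply]
    ring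
  have hsum : ∑ p, ∑ q, v p * squareDeviation x p q * v q =
      ∑ i, ⟪x i, X (x i)⟫ ^ 2 - Fintype.card κ * (2 / (d * (d + 2)) * frobSq e X) := by
    have : ∑ i, (⟪x i, X (x i)⟫ ^ 2 - 2 / (d * (d + 2)) * frobSq e X) =
        ∑ i, ⟪x i, X (x i)⟫ ^ 2 - Fintype.card κ * (2 / (d * (d + 2)) * frobSq e X) := by
      rw [Finset.sum_sub_distrib]
      simp
    rw [← this]
    simp only [← hone, squareDeviation, Matrix.sum_apply, Finset.mul_sum, Finset.sum_mul]
    calc _ = ∑ p, ∑ i, ∑ q, v p *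
          centredOuter (uniformSphere d 1) tracelessSquare (x i) p q * v q :=
          Finset.sum_congr rfl fun p _ => Finset.sum_comm
      _ = _ := Finset.sum_comm
  have h4 := Matrix.quadForm_pow_four_le (squareDeviation_isSymm x) v
  rw [hsum, hvF] at h4
  set Q := ∑ i, ⟪x i, X (x i)⟫ ^ 2
  set D := Q - Fintype.card κ * (2 / (d * (d + 2)) * frobSq e X) with hD
  have h5 : w * D ≤ 1 / 16 * frobSq e X := by
    refine le_of_pow_le_pow_left₀ (n := 4) (by norm_num) (by positivity) ?_
    calc (w * D) ^ 4 = w ^ 4 * D ^ 4 := by ring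
      _ ≤ w ^ 4 * _ := mul_le_mul_of_nonneg_left h4 (by positivity)
      _ = _ * frobSq e X ^ 4 := (mul_assoc _ _ _).symm
      _ ≤ (1 / 16) ^ 4 * frobSq e X ^ 4 := by gcongr
      _ = _ := by ring
  have h6 : w * Q = w * D + (w * Fintype.card κ) * (2 / (d * (d + 2))) * frobSq e X := by
    rw [hD]; ring
  -- For `d = 1` the mean factor `2 / (d + 2)` exceeds `1/2`, but a traceless operator is then zero.
  rcases hd.eq_or_lt with h | h
  · have hQ : Q = 0 := by
      refine Finset.sum_eq_zero fun i _ => ?_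
      have h0 : ∀ p, v p = 0 := by
        subst h
        intro p
        have : p = (0, 0) := Subsingleton.elim _ _
        rw [this]
        simpa using htr
      rw [← hvx]
      simp [h0]
    rw [hQ, mul_zero]
    positivity
  · have h7 : (d : ℝ) * (2 / (d * (d + 2))) ≤ 1 / 2 := by
      have : (2 : ℝ) ≤ d := by exact_mod_cast h
      rw [← mul_div_assoc, div_le_iff₀ (by positivity)]
      nlinarith
    rw [h6, hc]
    nlinarith

end QuadraticFormEvent

/-! ### Nets on the sphere and quadratic forms. -/

section Nets

open Module
open scoped RealInnerProductSpace

/-- The unit sphere has a `1 / 2`-net with at most `5 ^ d` points. -/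
theorem exists_sphere_net (E : Type*) [NormedAddCommGroup E] [InnerProductSpace ℝ E]
    [FiniteDimensional ℝ E] :
    ∃ N : Finset E, (∀ v ∈ N, ‖v‖ = 1) ∧ N.card ≤ 5 ^ finrank ℝ E ∧
      ∀ u : E, ‖u‖ = 1 → ∃ v ∈ N, ‖u - v‖ ≤ 1 / 2 := by
  classical
  set Q : ℕ → Prop := fun k => ∃ s : Finset E, (∀ v ∈ s, ‖v‖ = 1) ∧
    (∀ u ∈ s, ∀ v ∈ s, u ≠ v → 1 / 2 ≤ ‖u - v‖) ∧ s.card = k with hQ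
  have hbound : ∀ k, Q k → k ≤ 5 ^ finrank ℝ E := by
    rintro k ⟨s, h1, h2, rfl⟩
    have hinj : Function.Injective fun v : E => (2 : ℝ) • v :=
      smul_right_injective E (by norm_num)
    rw [← Finset.card_image_of_injective s hinj]
    refine Besicovitch.card_le_of_separated _ ?_ ?_
    · simp only [Finset.mem_image]
      rintro _ ⟨v, hv, rfl⟩
      rw [norm_smul, h1 v hv]
      norm_num
    · simp only [Finset.mem_image]
      rintro _ ⟨u, hu, rfl⟩ _ ⟨v, hv, rfl⟩ huv
      have := h2 u hu v hv fun h => huv (by rw [h])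
      rw [← smul_sub, norm_smul]
      norm_num
      linarith
  have h0 : Q 0 := ⟨∅, by simp⟩
  -- A `1/2`-separated set of maximal size is a net, since an uncovered point could be added. The
  -- size bound comes from doubling the set to norm `2` and separation `1`.
  obtain ⟨N, hN1, hN2, hN3⟩ := Nat.findGreatest_spec (Nat.zero_le (5 ^ finrank ℝ E)) h0
  refine ⟨N, hN1, hbound _ ⟨N, hN1, hN2, rfl⟩, fun u hu => ?_⟩
  by_contra! hcon
  have huN : u ∉ N := fun h => by
    have := hcon u h
    rw [sub_self, norm_zero] at this
    norm_num at this
  have hins : Q (N.card + 1) := by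
    refine ⟨insert u N, ?_, ?_, Finset.card_insert_of_notMem huN⟩
    · intro v hv
      rcases Finset.mem_insert.1 hv with rfl | hv
      · exact hu
      · exact hN1 v hv
    · intro a ha b hb hab
      rcases Finset.mem_insert.1 ha with ha' | ha' <;>
        rcases Finset.mem_insert.1 hb with hb' | hb'
      · exact absurd (ha'.trans hb'.symm) hab
      · rw [ha']; exact (hcon b hb').le
      · rw [hb', norm_sub_rev]; exact (hcon a ha').le
      · exact hN2 a ha' b hb' hab
  have := Nat.le_findGreatest (hbound _ hins) hins
  omega

/-- Compare an eigenvector `b` of largest absolute eigenvalue `M` with a nearby net point `v`: the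
forms differ by at most `M ‖b - v‖ ‖b + v‖`. The parallelogram law bounds that product of norms by
`√15 / 4 < 31/32`, leaving `M / 32 ≤ a`. -/
theorem LinearMap.IsSymmetric.abs_inner_le_of_net {E : Type*} [NormedAddCommGroup E]
    [InnerProductSpace ℝ E] [FiniteDimensional ℝ E] {D : E →ₗ[ℝ] E} (hD : D.IsSymmetric)
    {N : Finset E} (hN : ∀ v ∈ N, ‖v‖ = 1)
    (hnet : ∀ u : E, ‖u‖ = 1 → ∃ v ∈ N, ‖u - v‖ ≤ 1 / 2) {a : ℝ}
    (ha : ∀ v ∈ N, |⟪v, D v⟫| ≤ a) (u : E) : |⟪u, D u⟫| ≤ 32 * a * ‖u‖ ^ 2 := by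
  rcases subsingleton_or_nontrivial E with hE | hE
  · rw [Subsingleton.elim u 0]; simp
  have hfr : 0 < finrank ℝ E := finrank_pos
  have : Nonempty (Fin (finrank ℝ E)) := ⟨⟨0, hfr⟩⟩
  set b := hD.eigenvectorBasis rfl
  set l := hD.eigenvalues rfl
  have hDb : ∀ k, D (b k) = l k • b k := fun k => hD.apply_eigenvectorBasis rfl k
  obtain ⟨k, hk⟩ := Finite.exists_max fun k => |l k|
  set M := |l k|
  have hM0 : 0 ≤ M := abs_nonneg _
  have hnorm : ∀ v, ‖D v‖ ≤ M * ‖v‖ := by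
    intro v
    refine le_of_sq_le_sq ?_ (by positivity)
    rw [mul_pow, ← sum_inner_sq_eq b, ← sum_inner_sq_eq b v, Finset.mul_sum]
    refine Finset.sum_le_sum fun j _ => ?_
    rw [← hD, hDb, inner_smul_left, mul_pow]
    refine mul_le_mul_of_nonneg_right ?_ (sq_nonneg _)
    simp only [conj_trivial]
    rw [← sq_abs]
    exact pow_le_pow_left₀ (abs_nonneg _) (hk j) 2
  have hMk : M = |⟪b k, D (b k)⟫| := by
    rw [hDb, inner_smul_right, real_inner_self_eq_norm_sq, b.norm_eq_one]
    simp [M]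
  obtain ⟨v, hv, hbv⟩ := hnet (b k) (b.norm_eq_one k)
  have hdiff : |⟪b k, D (b k)⟫ - ⟪v, D v⟫| ≤ 31 / 32 * M := by
    have e1 : ⟪b k, D (b k)⟫ - ⟪v, D v⟫ = ⟪b k - v, D (b k + v)⟫ := by
      have : ⟪b k, D v⟫ = ⟪v, D (b k)⟫ := by rw [← hD, real_inner_comm]
      simp only [map_add, inner_sub_left, inner_add_right]
      linarith
    have hpar := parallelogram_law_with_norm ℝ (b k) v
    rw [b.norm_eq_one, hN v hv] at hpar
    have hprod : ‖b k - v‖ * ‖b k + v‖ ≤ 31 / 32 := by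
      refine le_of_sq_le_sq ?_ (by norm_num)
      have h1 : ‖b k + v‖ * ‖b k + v‖ = 4 - ‖b k - v‖ * ‖b k - v‖ := by linarith
      have h2 := norm_nonneg (b k - v)
      have h3 : (‖b k - v‖ * ‖b k + v‖) ^ 2 = ‖b k - v‖ ^ 2 * (4 - ‖b k - v‖ ^ 2) := by
        rw [mul_pow, sq ‖b k + v‖, h1]; ring
      rw [h3]
      have h4 : ‖b k - v‖ ^ 2 ≤ 1 / 4 := by nlinarith
      nlinarith
    rw [e1]
    refine (abs_real_inner_le_norm _ _).trans ?_
    calc ‖b k - v‖ * ‖D (b k + v)‖ ≤ ‖b k - v‖ * (M * ‖b k + v‖) := by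
          gcongr
          exact hnorm _
      _ = ‖b k - v‖ * ‖b k + v‖ * M := by ring
      _ ≤ 31 / 32 * M := by gcongr
  have hMa : M ≤ 32 * a := by
    have h1 := abs_sub_abs_le_abs_sub ⟪b k, D (b k)⟫ ⟪v, D v⟫
    rw [← hMk] at h1
    linarith [ha v hv]
  calc |⟪u, D u⟫| ≤ ‖u‖ * ‖D u‖ := abs_real_inner_le_norm _ _
    _ ≤ ‖u‖ * (M * ‖u‖) := by gcongr; exact hnorm u
    _ = M * ‖u‖ ^ 2 := by ring
    _ ≤ _ := by gcongr

end Nets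

/-! ### Concentration of squared coordinates. -/

section Chernoff

open scoped RealInnerProductSpace

theorem Real.exp_le_one_add_add_sq_mul_exp_abs (t : ℝ) :
    Real.exp t ≤ 1 + t + t ^ 2 * Real.exp |t| := by
  have h0 := Real.one_le_exp (abs_nonneg t)
  rcases le_or_gt |t| 1 with h | h
  · have h1 := (abs_le.1 (Real.abs_exp_sub_one_sub_id_le h)).2
    nlinarith [sq_nonneg t]
  · rcases le_total 0 t with ht | ht
    · rw [abs_of_nonneg ht] at h ⊢
      have h1 : 1 ≤ t ^ 2 := one_le_pow₀ h.le
      have h2 := le_mul_of_one_le_left (Real.exp_pos t).le h1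
      linarith
    · rw [abs_of_nonpos ht] at h h0 ⊢
      have h2 := Real.exp_le_one_iff.2 ht
      nlinarith [sq_nonneg t]

variable {d : ℕ}

/-- The centred normalized square of a coordinate. -/
noncomputable def centredSquare (v x : EuclideanSpace ℝ (Fin d)) : ℝ := d * ⟪x, v⟫ ^ 2 - 1

theorem continuous_centredSquare (v : EuclideanSpace ℝ (Fin d)) :
    Continuous (centredSquare v) := by
  unfold centredSquare
  fun_prop

/-- The linear term has mean zero. The quadratic remainder is absorbed by `s² ≤ 128 exp (|s|/8)`,
leaving an exponential moment of rate `1/4` that is at most `3`; hence `384 = 128 * 3`. -/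
theorem mgf_centredSquare_le (hd : 1 ≤ d) {v : EuclideanSpace ℝ (Fin d)} (hv : ‖v‖ = 1) {t : ℝ}
    (ht : |t| ≤ 1 / 8) :
    mgf (centredSquare v) (uniformSphere d 1) t ≤ Real.exp (384 * t ^ 2) := by
  have := isProbabilityMeasure_uniformSphere hd 1
  have hd0 : (0 : ℝ) < d := by exact_mod_cast hd
  have hcont := continuous_centredSquare v
  have hmean : ∫ x, centredSquare v x ∂uniformSphere d 1 = 0 := by
    have h1 := integral_inner_pow hd v 1
    have h2 := sphereMoment_succ hd 0
    rw [sphereMoment_zero] at h2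
    simp only [hv, mul_one, one_pow] at h1
    simp only [centredSquare]
    rw [integral_sub (integrable_uniformSphere hd (by fun_prop)) (integrable_const _),
      integral_const_mul, h1]
    norm_num at h2 ⊢
    linarith
  have hexp : ∫ x, Real.exp (|centredSquare v x| / 4) ∂uniformSphere d 1 ≤ 3 := by
    have h1 : ∀ x, Real.exp (|centredSquare v x| / 4) ≤
        Real.exp (1 / 4) * Real.exp (d * ⟪x, v⟫ ^ 2 / 4) := fun x => by
      rw [← Real.exp_add]
      refine Real.exp_le_exp.2 ?_
      have h2 : 0 ≤ d * ⟪x, v⟫ ^ 2 := by positivity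
      have h3 : |centredSquare v x| ≤ d * ⟪x, v⟫ ^ 2 + 1 := by
        rw [centredSquare, abs_le]
        constructor <;> linarith
      linarith
    calc _ ≤ ∫ x, Real.exp (1 / 4) * Real.exp (d * ⟪x, v⟫ ^ 2 / 4) ∂uniformSphere d 1 :=
          integral_mono (integrable_uniformSphere hd (by fun_prop))
            (integrable_uniformSphere hd (by fun_prop)) h1
      _ = Real.exp (1 / 4) * ∫ x, Real.exp (d * ⟪x, v⟫ ^ 2 / 4) ∂uniformSphere d 1 :=
          integral_const_mul _ _
      _ ≤ (3 / 2) * 2 := by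
          refine mul_le_mul ?_ (integral_exp_inner_sq_le hd hv)
            (integral_nonneg fun _ => (Real.exp_pos _).le) (by norm_num)
          have h4 := (abs_le.1 (Real.abs_exp_sub_one_sub_id_le (x := 1 / 4)
            (by rw [abs_of_pos] <;> norm_num))).2
          linarith
      _ = 3 := by norm_num
  have hpt : ∀ x, Real.exp (t * centredSquare v x) ≤
      1 + t * centredSquare v x + 128 * t ^ 2 * Real.exp (|centredSquare v x| / 4) := by
    intro x
    set s := centredSquare v x
    have h1 := Real.exp_le_one_add_add_sq_mul_exp_abs (t * s)
    have h2 : Real.exp |t * s| ≤ Real.exp (|s| / 8) := by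
      refine Real.exp_le_exp.2 ?_
      rw [abs_mul]
      nlinarith [abs_nonneg s]
    have h3 : s ^ 2 ≤ 128 * Real.exp (|s| / 8) := by
      have := Real.quadratic_le_exp_of_nonneg (x := |s| / 8) (by positivity)
      have h4 := abs_nonneg s
      have h5 := sq_abs s
      nlinarith
    have h6 : Real.exp (|s| / 4) = Real.exp (|s| / 8) * Real.exp (|s| / 8) := by
      rw [← Real.exp_add]; congr 1; ring
    have h7 := Real.exp_pos (|s| / 8)
    calc _ ≤ 1 + t * s + (t * s) ^ 2 * Real.exp |t * s| := h1
      _ ≤ 1 + t * s + (t * s) ^ 2 * Real.exp (|s| / 8) := by gcongr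
      _ = 1 + t * s + t ^ 2 * s ^ 2 * Real.exp (|s| / 8) := by ring
      _ ≤ 1 + t * s + t ^ 2 * (128 * Real.exp (|s| / 8)) * Real.exp (|s| / 8) := by gcongr
      _ = _ := by rw [h6]; ring
  have i1 : Integrable (fun x => 1 + t * centredSquare v x) (uniformSphere d 1) :=
    integrable_uniformSphere hd (by fun_prop)
  have i2 : Integrable (fun x => t * centredSquare v x) (uniformSphere d 1) :=
    integrable_uniformSphere hd (by fun_prop)
  have i3 : Integrable (fun x => 128 * t ^ 2 * Real.exp (|centredSquare v x| / 4))
      (uniformSphere d 1) := integrable_uniformSphere hd (by fun_prop)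
  calc mgf (centredSquare v) (uniformSphere d 1) t
      ≤ ∫ x, (1 + t * centredSquare v x + 128 * t ^ 2 * Real.exp (|centredSquare v x| / 4))
          ∂uniformSphere d 1 :=
        integral_mono (integrable_uniformSphere hd (by fun_prop)) (i1.add i3) hpt
    _ = 1 + 128 * t ^ 2 * ∫ x, Real.exp (|centredSquare v x| / 4) ∂uniformSphere d 1 := by
        rw [integral_add i1 i3, integral_add (integrable_const _) i2, integral_const_mul,
          integral_const_mul, hmean]
        simp
    _ ≤ 1 + 128 * t ^ 2 * 3 := by gcongr
    _ ≤ _ := by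
        have := Real.add_one_le_exp (384 * t ^ 2)
        linarith

theorem measure_abs_sum_centredSquare_ge_le (hd : 1 ≤ d) {κ : Type*} [Fintype κ]
    {v : EuclideanSpace ℝ (Fin d)} (hv : ‖v‖ = 1) {a : ℝ} (ha0 : 0 ≤ a) (ha : a ≤ 96) :
    (Measure.pi fun _ : κ => uniformSphere d 1).real
      {x | Fintype.card κ * a ≤ |∑ i, centredSquare v (x i)|} ≤
        2 * Real.exp (- (Fintype.card κ * a ^ 2 / 1536)) := by
  have := isProbabilityMeasure_uniformSphere hd 1
  set σ := uniformSphere d 1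
  set π := Measure.pi fun _ : κ => σ
  set Y : κ → (κ → EuclideanSpace ℝ (Fin d)) → ℝ := fun i x => centredSquare v (x i) with hY
  set n : ℝ := (Fintype.card κ : ℝ)
  have hm : Measurable (centredSquare v) := (continuous_centredSquare v).measurable
  have hYm : ∀ i, Measurable (Y i) := fun i => hm.comp (measurable_pi_apply i)
  have hind : iIndepFun Y π := iIndepFun_pi (X := fun _ => centredSquare v) fun _ => hm.aemeasurable
  have hmgf : ∀ t, |t| ≤ 1 / 8 → mgf (∑ i, Y i) π t ≤ Real.exp (384 * t ^ 2 * n) := by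
    intro t ht
    rw [hind.mgf_sum hYm]
    have h1 : ∀ i, mgf (Y i) π t ≤ Real.exp (384 * t ^ 2) := fun i => by
      have h2 : mgf (Y i) π t = mgf (centredSquare v) σ t := by
        have h3 := measurePreserving_eval (fun _ : κ => σ) i
        simp only [mgf]
        have h4 := integral_map (μ := π) (φ := fun x => x i) h3.measurable.aemeasurable
          (f := fun z => Real.exp (t * centredSquare v z))
          (Measurable.aestronglyMeasurable (by fun_prop))
        have h5 : Measure.map (fun x : κ → EuclideanSpace ℝ (Fin d) => x i) π = σ := h3.map_eq
        rw [h5] at h4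
        exact h4.symm
      rw [h2]
      exact mgf_centredSquare_le hd hv ht
    refine (Finset.prod_le_prod (fun i _ => mgf_nonneg) fun i _ => h1 i).trans ?_
    rw [Finset.prod_const, ← Real.exp_nat_mul, Finset.card_univ]
    exact Real.exp_le_exp.2 (le_of_eq (mul_comm _ _))
  have hb : ∀ᵐ x ∂π, ∀ i, |Y i x| ≤ d + 1 := by
    rw [ae_all_iff]
    intro i
    have h3 := measurePreserving_eval (fun _ : κ => σ) i
    filter_upwards [h3.quasiMeasurePreserving.ae norm_eq_one_ae_uniformSphere] with x hx
    have h1 := abs_real_inner_le_norm (x i) v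
    have h6 : ‖x i‖ = 1 := hx
    rw [h6, hv, mul_one] at h1
    have h2 : ⟪x i, v⟫ ^ 2 ≤ 1 := by rw [← sq_abs]; exact pow_le_one₀ (abs_nonneg _) h1
    have h4 : (0 : ℝ) ≤ d := by positivity
    have h5 : 0 ≤ (d : ℝ) * ⟪x i, v⟫ ^ 2 := by positivity
    simp only [hY, centredSquare]
    rw [abs_le]
    constructor <;> nlinarith
  have hint : ∀ t, Integrable (fun x => Real.exp (t * (∑ i, Y i) x)) π := by
    intro t
    refine Integrable.of_bound (C := Real.exp (|t| * (n * (d + 1))))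
      (Measurable.aestronglyMeasurable (by fun_prop)) ?_
    filter_upwards [hb] with x hx
    rw [Real.norm_eq_abs, abs_of_pos (Real.exp_pos _)]
    refine Real.exp_le_exp.2 ((le_abs_self _).trans ?_)
    rw [abs_mul, Finset.sum_apply]
    refine mul_le_mul_of_nonneg_left ((Finset.abs_sum_le_sum_abs _ _).trans ?_) (abs_nonneg _)
    refine (Finset.sum_le_sum fun i _ => hx i).trans (le_of_eq ?_)
    simp [n]
    ring
  -- The minimizer of `384 t² - t a`; the condition `a ≤ 96` is exactly `t ≤ 1/8`.
  set t := a / 768 with ht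
  have ht0 : 0 ≤ t := by positivity
  have ht8 : |t| ≤ 1 / 8 := by rw [abs_of_nonneg ht0, ht]; linarith
  have h1 := measure_ge_le_exp_mul_mgf (n * a) ht0 (hint t)
  have h2 := measure_le_le_exp_mul_mgf (- (n * a)) (neg_nonpos.2 ht0) (hint (-t))
  have hval : Real.exp (- t * (n * a)) * Real.exp (384 * t ^ 2 * n) =
      Real.exp (- (n * a ^ 2 / 1536)) := by
    rw [← Real.exp_add, ht]
    congr 1
    ring
  have h1' : π.real {x | n * a ≤ (∑ i, Y i) x} ≤ Real.exp (- (n * a ^ 2 / 1536)) := by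
    rw [← hval]
    exact h1.trans (mul_le_mul_of_nonneg_left (hmgf t ht8) (Real.exp_pos _).le)
  have h2' : π.real {x | (∑ i, Y i) x ≤ - (n * a)} ≤ Real.exp (- (n * a ^ 2 / 1536)) := by
    rw [← hval]
    refine h2.trans ?_
    have := hmgf (-t) (by rwa [abs_neg])
    rw [neg_sq] at this
    have e1 : - -t * -(n * a) = -t * (n * a) := by ring
    rw [e1]
    exact mul_le_mul_of_nonneg_left this (Real.exp_pos _).le
  calc _ ≤ π.real ({x | n * a ≤ (∑ i, Y i) x} ∪ {x | (∑ i, Y i) x ≤ - (n * a)}) := by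
        refine measureReal_mono fun x hx => ?_
        simp only [Set.mem_ofPred_eq, Set.mem_union, Finset.sum_apply] at hx ⊢
        rcases le_abs.1 hx with h | h
        · exact Or.inl h
        · exact Or.inr (by linarith)
    _ ≤ _ := (measureReal_union_le _ _).trans (by linarith)

end Chernoff

/-! ### The event of probability `0.99`. -/

section GoodEvent

open scoped RealInnerProductSpace

variable {d : ℕ} {κ : Type*} [Fintype κ]

theorem boundedEntries_squareDeviation (hd : 1 ≤ d) :
    BoundedEntries (Measure.pi fun _ : κ => uniformSphere d 1) squareDeviation := by
  have := isProbabilityMeasure_uniformSphere hd 1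
  have hb : BoundedEntries (uniformSphere d 1)
      (centredOuter (uniformSphere d 1) (tracelessSquare (d := d))) :=
    boundedEntries_centredOuter (fun p => (continuous_tracelessSquare p).measurable)
      (norm_eq_one_ae_uniformSphere.mono fun x hx => sum_tracelessSquare_sq_le hx)
  exact BoundedEntries.sum (Z := fun (i : κ) (x : κ → EuclideanSpace ℝ (Fin d)) =>
    centredOuter (uniformSphere d 1) tracelessSquare (x i))
    (fun i a b => (hb a b).comp_measurePreserving
      (measurePreserving_eval (fun _ : κ => uniformSphere d 1) i)) Finset.univ

theorem measurable_squareDeviation : Measurable (squareDeviation (d := d) (κ := κ)) := by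
  refine Matrix.measurable_of_apply fun p q => ?_
  simp only [squareDeviation, Matrix.sum_apply]
  refine Finset.measurable_sum _ fun i _ => ?_
  exact ((Matrix.measurable_apply p q).comp (measurable_centredOuter
    fun p => (continuous_tracelessSquare p).measurable)).comp (measurable_pi_apply i)

/-- The trace of the fourth power of `squareDeviation`. -/
noncomputable def deviationTrace (x : κ → EuclideanSpace ℝ (Fin d)) : ℝ :=
  (squareDeviation x * squareDeviation x * (squareDeviation x * squareDeviation x)).trace

theorem measurable_deviationTrace : Measurable (deviationTrace (d := d) (κ := κ)) := by
  have h := measurable_squareDeviation (d := d) (κ := κ)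
  have h4 := Matrix.measurable_mul (Matrix.measurable_mul h h) (Matrix.measurable_mul h h)
  change Measurable fun x => ∑ a, (squareDeviation x * squareDeviation x *
    (squareDeviation x * squareDeviation x)) a a
  exact Finset.measurable_sum _ fun a _ => (Matrix.measurable_apply a a).comp h4

theorem deviationTrace_nonneg (x : κ → EuclideanSpace ℝ (Fin d)) : 0 ≤ deviationTrace x := by
  refine Matrix.trace_mul_self_nonneg ?_
  change (squareDeviation x * squareDeviation x).transpose = _
  rw [Matrix.transpose_mul, squareDeviation_isSymm]

theorem integral_deviationTrace_le (hd : 1 ≤ d) :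
    ∫ x, deviationTrace x ∂(Measure.pi fun _ : κ => uniformSphere d 1) ≤
      16 / d ^ 2 * Fintype.card κ ^ 2 + 48 * Fintype.card κ := by
  have := isProbabilityMeasure_uniformSphere hd 1
  have hd0 : (0 : ℝ) < d := by exact_mod_cast hd
  refine (integral_trace_sum_centredOuter_pow_four_le
    (fun p => (continuous_tracelessSquare p).measurable)
    (norm_eq_one_ae_uniformSphere.mono fun x hx => sum_tracelessSquare_sq_le hx)
    (by positivity) (integral_tracelessSquare_sq_le hd)).trans ?_
  have : 8 * (2 / ((d : ℝ) * (d + 2))) ≤ 16 / d ^ 2 := by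
    rw [← mul_div_assoc]
    norm_num
    gcongr
    nlinarith
  gcongr

/-- Markov's inequality. With `d = t⁶` the scaled expectation is at most `16 (t⁶/n)² + 48 (t⁸/n)³`;
the last term requires `n` of order `t⁸ = d^{4/3}`. -/
theorem measure_deviationTrace_ge_le (hd : 1 ≤ d) {K : ℝ} (hK : 10 ^ 6 ≤ K) {t n : ℝ}
    (hn : n = Fintype.card κ) (ht1 : 1 ≤ t) (ht : t ^ 6 = d) (hKn : K * t ^ 8 ≤ n) :
    (Measure.pi fun _ : κ => uniformSphere d 1).real
      {x | (1 / 16) ^ 4 ≤ (d / n) ^ 4 * deviationTrace x} ≤ 1 / 1000 := by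
  have := isProbabilityMeasure_uniformSphere hd 1
  set π := Measure.pi fun _ : κ => uniformSphere d 1
  have hb := boundedEntries_squareDeviation (κ := κ) hd
  have hint : Integrable (fun x => (d / n) ^ 4 * deviationTrace x) π :=
    ((hb.mul hb).mul (hb.mul hb)).integrable_trace.const_mul _
  have hmarkov := mul_meas_ge_le_integral_of_nonneg (μ := π)
    (Filter.Eventually.of_forall fun x => mul_nonneg (by positivity) (deviationTrace_nonneg x))
    hint ((1 / 16) ^ 4)
  have hI : ∫ x, (d / n) ^ 4 * deviationTrace x ∂π ≤ 64 / K ^ 2 := by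
    have hK0 : 0 < K := by linarith
    have ht8 : 1 ≤ t ^ 8 := one_le_pow₀ ht1
    have hn0 : 0 < n := by nlinarith
    have h1 := integral_deviationTrace_le (κ := κ) hd
    rw [integral_const_mul]
    refine (mul_le_mul_of_nonneg_left h1 (by positivity)).trans ?_
    rw [← hn, ← ht]
    have ht0 : 0 < t := by linarith
    have e1 : (t ^ 6 / n) ^ 4 * (16 / (t ^ 6) ^ 2 * n ^ 2 + 48 * n) =
        16 * (t ^ 6 / n) ^ 2 + 48 * (t ^ 8 / n) ^ 3 := by
      field_simp
    have h2 : t ^ 8 / n ≤ 1 / K := by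
      rw [div_le_div_iff₀ hn0 hK0]
      linarith
    have h3 : t ^ 6 / n ≤ 1 / K := by
      exact (div_le_div_of_nonneg_right (pow_le_pow_right₀ ht1 (by norm_num)) hn0.le).trans h2
    have h4 : (1 / K) ^ 3 ≤ (1 / K) ^ 2 := by
      refine pow_le_pow_of_le_one (by positivity) ?_ (by norm_num)
      rw [div_le_one hK0]
      linarith
    rw [e1]
    calc _ ≤ 16 * (1 / K) ^ 2 + 48 * (1 / K) ^ 3 := by gcongr
      _ ≤ 16 * (1 / K) ^ 2 + 48 * (1 / K) ^ 2 := by gcongr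
      _ = _ := by ring
  have hK2 : 64 / K ^ 2 ≤ (1 / 16) ^ 4 * (1 / 1000) := by
    have : (10 ^ 6 : ℝ) ^ 2 ≤ K ^ 2 := pow_le_pow_left₀ (by norm_num) hK 2
    rw [div_le_iff₀ (by positivity)]
    nlinarith
  have h5 := (hmarkov.trans hI).trans hK2
  exact le_of_mul_le_mul_left h5 (by norm_num)

theorem nearParseval_of_net {n : ℝ} (hn : n = Fintype.card κ) (hn0 : 0 < n)
    {N : Finset (EuclideanSpace ℝ (Fin d))} (hN : ∀ v ∈ N, ‖v‖ = 1)
    (hnet : ∀ u : EuclideanSpace ℝ (Fin d), ‖u‖ = 1 → ∃ v ∈ N, ‖u - v‖ ≤ 1 / 2) {a : ℝ}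
    {x : κ → EuclideanSpace ℝ (Fin d)}
    (ha : ∀ v ∈ N, |∑ i, centredSquare v (x i)| ≤ n * a) :
    NearParseval (d / n) (32 * a) x := by
  intro u
  have h1 := (frameError_isSymmetric (d / n) x).abs_inner_le_of_net hN hnet (a := a) (fun v hv => by
    have h2 : ⟪v, frameError (d / n) x v⟫ = (∑ i, centredSquare v (x i)) / n := by
      rw [inner_frameError_self, hN v hv]
      simp only [centredSquare, Finset.sum_sub_distrib, ← Finset.mul_sum]
      rw [sub_div]
      simp only [Finset.sum_const, Finset.card_univ, nsmul_eq_mul, mul_one, one_pow]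
      rw [← hn, div_self hn0.ne']
      ring
    rw [h2, abs_div, abs_of_pos hn0, div_le_iff₀ hn0, mul_comm a]
    exact ha v hv) u
  rw [inner_frameError_self, abs_le] at h1
  constructor <;> linarith

/-- A random frame is nearly Parseval and satisfies the quadratic form bound with probability at
least `0.99`. -/
theorem exists_good_event (hd : 1 ≤ d) {K : ℝ} (hK : 10 ^ 15 ≤ K) {t n : ℝ}
    (hn : n = Fintype.card κ) (ht1 : 1 ≤ t) (ht : t ^ 6 = d) (hKn : K * t ^ 8 ≤ n) :
    ∃ G : Set (κ → EuclideanSpace ℝ (Fin d)), MeasurableSet G ∧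
      (0.99 : ℝ) ≤ (Measure.pi fun _ : κ => uniformSphere d 1).real G ∧
      ∀ x ∈ G, (∀ i, ‖x i‖ = 1) ∧
        QuadBound (EuclideanSpace.basisFun (Fin d) ℝ) (d / n) (3 / 4) x ∧
        ∃ e, 0 ≤ e ∧ e * t ≤ 1 / 4000 ∧ NearParseval (d / n) e x := by
  have := isProbabilityMeasure_uniformSphere hd 1
  set π := Measure.pi fun _ : κ => uniformSphere d 1
  have hK0 : 0 < K := by linarith
  have ht0 : 0 < t := by linarith
  have ht8 : 1 ≤ t ^ 8 := one_le_pow₀ ht1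
  have hn0 : 0 < n := by nlinarith
  have hd0 : (0 : ℝ) < d := by exact_mod_cast hd
  obtain ⟨N, hN1, hN2, hN3⟩ := exists_sphere_net (EuclideanSpace ℝ (Fin d))
  rw [finrank_euclideanSpace_fin] at hN2
  -- Makes the Chernoff exponent `22500 d / 1536 ≥ 14 d`, enough to beat the `5^d` points of the
  -- net.
  set a := 150 * Real.sqrt (d / n) with ha
  have ha0 : 0 ≤ a := by positivity
  have ha2 : a ^ 2 = 22500 * (d / n) := by
    rw [ha, mul_pow, Real.sq_sqrt (by positivity)]
    norm_num
  have hdn : (d : ℝ) / n * t ^ 2 ≤ 1 / K := by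
    rw [← ht, div_mul_eq_mul_div, ← pow_add, div_le_div_iff₀ hn0 hK0]
    norm_num
    linarith
  have h1K : 1 / K ≤ 1 / 10 ^ 15 := one_div_le_one_div_of_le (by norm_num) hK
  -- The net loses a factor `32`, and `32 / 128000 = 1/4000` is the threshold of the iteration; this
  -- dictates `K ≥ 10^15`.
  have hat : a * t ≤ 1 / 128000 := by
    refine le_of_sq_le_sq ?_ (by norm_num)
    have h := hdn.trans h1K
    rw [mul_pow, ha2, mul_assoc]
    norm_num at h ⊢
    linarith
  have ha96 : a ≤ 96 := by nlinarith
  set A : Set (κ → EuclideanSpace ℝ (Fin d)) := {x | ∀ i, ‖x i‖ = 1}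
  set B : Set (κ → EuclideanSpace ℝ (Fin d)) :=
    {x | (1 / 16) ^ 4 ≤ (d / n) ^ 4 * deviationTrace x} with hB
  set C : EuclideanSpace ℝ (Fin d) → Set (κ → EuclideanSpace ℝ (Fin d)) :=
    fun v => {x | Fintype.card κ * a ≤ |∑ i, centredSquare v (x i)|} with hC
  have hAm : MeasurableSet A := by
    have : A = ⋂ i, {x | ‖x i‖ = 1} := by ext; simp [A]
    rw [this]
    exact MeasurableSet.iInter fun i => measurableSet_eq_fun (by fun_prop) (by fun_prop)
  have hBm : MeasurableSet B :=
    measurableSet_le measurable_const (measurable_deviationTrace.const_mul _)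
  have hCm : ∀ v, MeasurableSet (C v) := fun v => by
    have := (continuous_centredSquare v).measurable
    exact measurableSet_le (by fun_prop) (by fun_prop)
  have hA : π.real Aᶜ = 0 := by
    rw [measureReal_eq_zero_iff]
    have h : ∀ᵐ x ∂π, ∀ i, ‖x i‖ = 1 := by
      rw [ae_all_iff]
      intro i
      exact (measurePreserving_eval (fun _ : κ => uniformSphere d 1)
        i).quasiMeasurePreserving.ae norm_eq_one_ae_uniformSphere
    exact h
  have hBp : π.real B ≤ 1 / 1000 :=
    measure_deviationTrace_ge_le hd (le_trans (by norm_num) hK) hn ht1 ht hKn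
  have hCp : π.real (⋃ v ∈ N, C v) ≤ 1 / 1000 := by
    have h1 : ∀ v ∈ N, π.real (C v) ≤ 2 * Real.exp (-14) ^ d := fun v hv => by
      refine (measure_abs_sum_centredSquare_ge_le hd (hN1 v hv) ha0 ha96).trans ?_
      rw [← Real.exp_nat_mul, ← hn, ha2]
      gcongr
      have : n * (22500 * (d / n)) = 22500 * d := by field_simp
      rw [this]
      linarith
    have h2 : Real.exp (-14) ≤ 1 / 16384 := by
      rw [Real.exp_neg, ← one_div]
      refine one_div_le_one_div_of_le (by norm_num) ?_
      have h3 : (2 : ℝ) ≤ Real.exp 1 := by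
        have := Real.add_one_le_exp (1 : ℝ)
        linarith
      have h4 := pow_le_pow_left₀ (by norm_num) h3 14
      rw [← Real.exp_nat_mul] at h4
      norm_num at h4
      linarith
    calc π.real (⋃ v ∈ N, C v) ≤ ∑ v ∈ N, π.real (C v) := measureReal_biUnion_finset_le _ _
      _ ≤ ∑ _v ∈ N, 2 * Real.exp (-14) ^ d := Finset.sum_le_sum h1
      _ = N.card * (2 * Real.exp (-14) ^ d) := by simp
      _ ≤ 5 ^ d * (2 * (1 / 16384) ^ d) := by
          have : (N.card : ℝ) ≤ 5 ^ d := by exact_mod_cast hN2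
          gcongr
      _ = 2 * (5 / 16384) ^ d := by
          rw [mul_left_comm, ← mul_pow]
          norm_num
      _ ≤ 2 * (5 / 16384) ^ 1 := by
          refine mul_le_mul_of_nonneg_left ?_ (by norm_num)
          exact pow_le_pow_of_le_one (by norm_num) (by norm_num) hd
      _ ≤ 1 / 1000 := by norm_num
  have hUm : MeasurableSet (⋃ v ∈ N, C v) := N.measurableSet_biUnion fun v _ => hCm v
  refine ⟨(Aᶜ ∪ (B ∪ ⋃ v ∈ N, C v))ᶜ, (hAm.compl.union (hBm.union hUm)).compl, ?_, ?_⟩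
  · rw [probReal_compl_eq_one_sub (hAm.compl.union (hBm.union hUm))]
    have h1 := measureReal_union_le (μ := π) Aᶜ (B ∪ ⋃ v ∈ N, C v)
    have h2 := measureReal_union_le (μ := π) B (⋃ v ∈ N, C v)
    norm_num at hBp hCp ⊢
    linarith
  · intro x hx
    simp only [Set.mem_compl_iff, Set.mem_union, Set.mem_iUnion, not_or, not_not, not_exists] at hx
    obtain ⟨hxA, hxB, hxC⟩ := hx
    refine ⟨hxA, ?_, 32 * a, by positivity, by linarith, ?_⟩
    · refine quadBound_of_squareDeviation hd ?_ ?_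
      · rw [← hn]
        field_simp
      · exact (not_le.1 hxB).le
    · refine nearParseval_of_net hn hn0 hN1 hN3 fun v hv => ?_
      have h : ¬ (Fintype.card κ * a ≤ |∑ i, centredSquare v (x i)|) := hxC v hv
      have := (not_le.1 h).le
      rwa [← hn] at this

end GoodEvent

/-! ### Translation between matrices and operators. -/

section FrameMatrices

open scoped RealInnerProductSpace

variable {d n : ℕ}

theorem frameOperator_apply (U : Fin n → EuclideanSpace ℝ (Fin d)) (a b : Fin d) :
    frameOperator U a b = ∑ i, U i a * U i b := by
  simp [frameOperator, Matrix.sum_apply, Matrix.vecMulVec_apply]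

theorem dotProduct_frameOperator (U : Fin n → EuclideanSpace ℝ (Fin d))
    (v : EuclideanSpace ℝ (Fin d)) :
    dotProduct v.ofLp ((frameOperator U).mulVec v.ofLp) = ∑ i, ⟪U i, v⟫ ^ 2 := by
  have h : ∀ i, ⟪U i, v⟫ = ∑ a, U i a * v a := fun i => by
    simp [PiLp.inner_apply, mul_comm]
  simp only [h, dotProduct, Matrix.mulVec, frameOperator_apply, sq,
    Finset.mul_sum, Finset.sum_mul]
  calc _ = ∑ a, ∑ i, ∑ b, v a * (U i a * U i b * v b) :=
        Finset.sum_congr rfl fun a _ => Finset.sum_comm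
    _ = _ := by
        rw [Finset.sum_comm]
        exact Finset.sum_congr rfl fun i _ => Finset.sum_congr rfl fun a _ =>
          Finset.sum_congr rfl fun b _ => by ring

theorem IsNearlyParseval.nearParseval {ε r w : ℝ} (hr : r ^ 2 = w)
    {x : Fin n → EuclideanSpace ℝ (Fin d)} (h : IsNearlyParseval ε fun i => r • x i) :
    NearParseval w ε x := by
  intro v
  have h1 := h.1.dotProduct_mulVec_nonneg v.ofLp
  have h2 := h.2.dotProduct_mulVec_nonneg v.ofLp
  have hv : dotProduct v.ofLp v.ofLp = ‖v‖ ^ 2 := by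
    rw [EuclideanSpace.real_norm_sq_eq]
    simp [dotProduct, sq]
  have hq : ∑ i, ⟪r • x i, v⟫ ^ 2 = w * ∑ i, ⟪x i, v⟫ ^ 2 := by
    simp only [inner_smul_left, mul_pow, conj_trivial, hr, Finset.mul_sum]
  simp only [star_trivial, Matrix.sub_mulVec, Matrix.smul_mulVec, Matrix.one_mulVec,
    dotProduct_sub, dotProduct_smul, dotProduct_frameOperator, hv, hq, smul_eq_mul] at h1 h2
  constructor <;> linarith

theorem frameOperator_smul_eq_one {r w : ℝ} (hr : r ^ 2 = w)
    {y : Fin n → EuclideanSpace ℝ (Fin d)} (hy : ∀ v, w * ∑ i, ⟪y i, v⟫ ^ 2 = ‖v‖ ^ 2) :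
    frameOperator (fun i => r • y i) = 1 := by
  have hpol : ∀ u v, w * ∑ i, ⟪y i, u⟫ * ⟪y i, v⟫ = ⟪u, v⟫ := by
    intro u v
    have h1 := hy (u + v)
    have h2 : ∑ i, ⟪y i, u + v⟫ ^ 2 =
        ∑ i, ⟪y i, u⟫ ^ 2 + 2 * ∑ i, ⟪y i, u⟫ * ⟪y i, v⟫ + ∑ i, ⟪y i, v⟫ ^ 2 := by
      rw [Finset.mul_sum, ← Finset.sum_add_distrib, ← Finset.sum_add_distrib]
      exact Finset.sum_congr rfl fun i _ => by rw [inner_add_right]; ring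
    rw [h2, norm_add_sq_real, ← hy u, ← hy v] at h1
    linarith
  have hc : ∀ i a, ⟪y i, EuclideanSpace.basisFun (Fin d) ℝ a⟫ = y i a := fun i a => by
    rw [real_inner_comm, ← OrthonormalBasis.repr_apply_apply]
    simp
  ext a b
  have h := hpol (EuclideanSpace.basisFun (Fin d) ℝ a) (EuclideanSpace.basisFun (Fin d) ℝ b)
  rw [(EuclideanSpace.basisFun (Fin d) ℝ).inner_eq_ite] at h
  rw [Matrix.one_apply, ← h, frameOperator_apply, Finset.mul_sum]
  refine Finset.sum_congr rfl fun i _ => ?_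
  rw [hc, hc, ← hr]
  simp only [PiLp.smul_apply, smul_eq_mul]
  ring

/-- Two accuracies play different roles: `e`, from the random event, keeps the iteration running,
while `ε` only bounds the initial Frobenius error and hence the distance. So no smallness of `ε` is
needed. -/
theorem exists_isDoublyBalanced (hd : 1 ≤ d) (hn : 0 < n) {t e ε : ℝ} (ht1 : 1 ≤ t)
    (ht : t ^ 6 = d) {x : Fin n → EuclideanSpace ℝ (Fin d)} (hx1 : ∀ i, ‖x i‖ = 1)
    (hQ : QuadBound (EuclideanSpace.basisFun (Fin d) ℝ) ((d : ℝ) / n) (3 / 4) x)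
    (he0 : 0 ≤ e) (het : e * t ≤ 1 / 4000) (he : NearParseval ((d : ℝ) / n) e x)
    (hε : IsNearlyParseval ε fun i => Real.sqrt ((d : ℝ) / n) • x i) :
    ∃ V : Fin n → EuclideanSpace ℝ (Fin d), IsDoublyBalanced V ∧
      frameDist (fun i => Real.sqrt ((d : ℝ) / n) • x i) V ≤ 125 * d * ε ^ 2 := by
  have hn0 : (0 : ℝ) < n := by exact_mod_cast hn
  have hd0 : (0 : ℝ) < d := by exact_mod_cast hd
  set w := (d : ℝ) / n with hw
  have hw0 : 0 < w := by positivity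
  set r := Real.sqrt w
  have hr : r ^ 2 = w := Real.sq_sqrt hw0.le
  set b := EuclideanSpace.basisFun (Fin d) ℝ
  have hεx := hε.nearParseval hr
  -- The two-sided bound at a unit vector forces `1 - ε ≤ 1 + ε`.
  have hε0 : 0 ≤ ε := by
    have := hεx (b ⟨0, hd⟩)
    rw [b.norm_eq_one] at this
    linarith
  obtain ⟨y, hy1, hy2, hy3⟩ := exists_balanced_frame b hw0 he0 ht1 (by simpa using ht) het hx1
    (by rw [hw]; simp; field_simp) he hQ
  refine ⟨fun i => r • y i, ⟨frameOperator_smul_eq_one hr hy2, fun i => ?_⟩, ?_⟩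
  · rw [norm_smul, mul_pow, hy1, Real.norm_eq_abs, sq_abs, hr]
    ring
  · have h1 : frameDist (fun i => r • x i) (fun i => r • y i) = w * ∑ i, ‖x i - y i‖ ^ 2 := by
      simp only [frameDist, ← smul_sub, norm_smul, mul_pow, Real.norm_eq_abs, sq_abs, hr,
        Finset.mul_sum]
    have h2 := frobSq_le_of_norm_le b (hεx.norm_frameError_le hε0)
    rw [Fintype.card_fin] at h2
    rw [h1]
    linarith

end FrameMatrices

theorem theoremt :
    ∃ K C : ℝ, 0 < K ∧ 0 < C ∧
      ∀ (d n : ℕ), 1 ≤ d → K * (d : ℝ) ^ (4 / 3 : ℝ) ≤ (n : ℝ) →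
      ∀ {Ω : Type*} [MeasurableSpace Ω] (P : Measure Ω) [IsProbabilityMeasure P]
        (U : Fin n → Ω → EuclideanSpace ℝ (Fin d)),
        (∀ i, HasLaw (U i) (uniformSphere d (Real.sqrt ((d : ℝ) / n))) P) →
        iIndepFun U P →
        ∃ E : Set Ω, MeasurableSet E ∧ (0.99 : ℝ) ≤ P.real E ∧
          ∀ ω ∈ E, ∀ ε : ℝ, IsNearlyParseval ε (fun i => U i ω) →
            ∃ V : Fin n → EuclideanSpace ℝ (Fin d),
              IsDoublyBalanced V ∧ frameDist (fun i => U i ω) V ≤ C * d * ε ^ 2 := by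
  refine ⟨10 ^ 15, 125, by norm_num, by norm_num, ?_⟩
  intro d n hd hn Ω _ P _ U hU hind
  have hd1 : (1 : ℝ) ≤ d := by exact_mod_cast hd
  set t : ℝ := (d : ℝ) ^ (1 / 6 : ℝ) with ht
  have ht1 : 1 ≤ t := Real.one_le_rpow hd1 (by norm_num)
  have ht6 : t ^ 6 = d := by
    rw [ht, ← Real.rpow_natCast, ← Real.rpow_mul (by positivity)]
    norm_num
  have ht8 : t ^ 8 = (d : ℝ) ^ (4 / 3 : ℝ) := by
    rw [ht, ← Real.rpow_natCast, ← Real.rpow_mul (by positivity)]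
    norm_num
  rw [← ht8] at hn
  have hn0' : (0 : ℝ) < n := by
    have : 1 ≤ t ^ 8 := one_le_pow₀ ht1
    linarith
  have hn0 : 0 < n := by exact_mod_cast hn0'
  set r := Real.sqrt ((d : ℝ) / n) with hr
  have hr0 : r ≠ 0 := (Real.sqrt_pos.2 (by positivity)).ne'
  have := isProbabilityMeasure_uniformSphere hd 1
  obtain ⟨G, hGm, hGp, hG⟩ := exists_good_event (κ := Fin n) hd le_rfl (n := n) (by simp) ht1 ht6 hn
  set X : Fin n → Ω → EuclideanSpace ℝ (Fin d) := fun i ω => r⁻¹ • U i ω with hX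
  have hXm : ∀ i, AEMeasurable (X i) P := fun i =>
    Measurable.comp_aemeasurable (g := fun x => r⁻¹ • x) (by fun_prop) (hU i).aemeasurable
  have hXlaw : ∀ i, P.map (X i) = uniformSphere d 1 := by
    intro i
    have h1 : P.map (X i) = (P.map (U i)).map (fun x => r⁻¹ • x) :=
      (AEMeasurable.map_map_of_aemeasurable (Measurable.aemeasurable (by fun_prop))
        (hU i).aemeasurable).symm
    rw [h1, (hU i).map_eq, ← map_smul_uniformSphere, Measure.map_map (by fun_prop) (by fun_prop)]
    have h2 : ((fun x : EuclideanSpace ℝ (Fin d) => r⁻¹ • x) ∘ fun x => r • x) = id := by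
      funext x
      simp [smul_smul, inv_mul_cancel₀ hr0]
    rw [h2, Measure.map_id]
  have hXind : iIndepFun X P := hind.comp (fun _ x => r⁻¹ • x) fun _ => by fun_prop
  have hlaw : P.map (fun ω i => X i ω) = Measure.pi fun _ : Fin n => uniformSphere d 1 := by
    rw [(iIndepFun_iff_map_fun_eq_pi_map hXm).1 hXind]
    simp only [hXlaw]
  have hΦ : AEMeasurable (fun ω i => X i ω) P := aemeasurable_pi_lambda _ hXm
  -- The `U i` are only almost everywhere measurable, so the preimage of `G` is replaced by a
  -- measurable subset of full measure in it.
  obtain ⟨E, hE1, hE2, hE3⟩ := (hΦ.nullMeasurableSet_preimage hGm).exists_measurable_subset_ae_eq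
  refine ⟨E, hE2, ?_, fun ω hω ε hε => ?_⟩
  · rw [measureReal_congr hE3, ← map_measureReal_apply_of_aemeasurable hΦ hGm, hlaw]
    exact hGp
  · obtain ⟨hx1, hQ, e, he0, het, he⟩ := hG _ (hE1 hω)
    have hUX : (fun i => U i ω) = fun i => r • X i ω := by
      funext i
      simp [hX, smul_smul, mul_inv_cancel₀ hr0]
    rw [hUX] at hε ⊢
    exact exists_isDoublyBalanced hd hn0 ht1 ht6 hx1 hQ he0 het he hε
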